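/- Let $\mathbb{K}$ be a field and let all gradings be $\mathbb{Z}$-gradings (or $\mathbb{Z}/2\mathbb{Z}$-gradings; more generally gradings by a commutative ring $\Gamma$ for which the signs $(-1)^i$, $i\in\Gamma$, are defined). Let $A$ be a strictly unital $A_\infty$-algebra over $\mathbb{K}$ and let $M,N$ be strictly unital left $A_\infty$-modules over $A$. Write $\mathrm{Hom}(M,N)$ for the complex of strictly unital morphisms, i.e. graded maps $\phi: T(A[1])\otimes M\to N$ that vanish whenever one of the entries from $A$ is the unit, with differential $d\phi=\phi\circ b_M-(-1)^{|\phi|}\mu_N\circ b_\phi$, where $b_M$ is the bar differential and $b_\phi=(1\otimes\phi)\circ\Delta$. For $q\ge 0$ let $F^{q}\mathrm{Hom}(M,N)$ be the subcomplex of those $\phi$ that vanish on $A[1]^{\otimes i}\otimes M$ for all $i<q$. Let $\mathcal{G}=\{\mathcal{G}^kN\}_{k\in\mathbb{Z}}$ be an increasing filtration of $N$ by graded $A_\infty$-submodules with $\mathcal{G}^{-1}N=0$ and $\bigcup_k\mathcal{G}^kN=N$. Let $N_t=N/\mathcal{G}^tN$, and let $\pi_t:N\to N_t$ be the projection. Regard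 $(N,\mathcal{G})$ as a filtered complex with differential $\mu^0_N$ (the part of the structure map with no input from $A$). Let $H(N)_k\subseteq H(N)$ be the image of the cocycles lying in $\mathcal{G}^kN$, and let the length be $\ell(N)=\max(|\ell_+|,|\ell_-|)$ with $\ell_+=\inf\{k: H(N)_k=H(N)\}$ and $\ell_-=\inf\{k:H(N)_k\neq 0\}$ (and $\ell(N)=0$ if $H(N)=0$). Let $n,s\ge 0$ be integers. Suppose that $\ell(N)\le n$ and that the spectral sequence of the filtered complex $(N,\mathcal{G})$ degenerates at the page $s+1$, i.e. all differentials $d_r: E^r_k\to E^r_{k-r}$ with $r\ge s+1$ vanish. Then for every integer $p\ge 0$ the pushforward $$(\pi_{n+sp})_*:\mathrm{Hom}(M,N)\to \mathrm{Hom}(M,N_{n+sp})$$ lifts up to homotopy into $F^{p+1}\mathrm{Hom}(M,N_{n+sp})$: there is a cochain map $\gamma:\mathrm{Hom}(M,N)\to F^{p+1}\mathrm{Hom}(M,N_{n+sp})$ of degree $0$ whose composition with the inclusion $F^{p+1}\mathrm{Hom}(M,N_{n+sp})\hookrightarrow\mathrm{Hom}(M,N_{n+sp})$ is cochain homotopic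 to $(\pi_{n+sp})_*$. -/

import Mathlib

open scoped DirectSum ENNReal

noncomputable section

namespace AInf

/-! ### Graded vector spaces and words

A graded vector space is a `K`-vector space `V` with an internal direct sum decomposition
`V = ⨁ i, 𝒱 i`. The index ring `Γ` of the grading is any commutative ring for which the signs
`(-1) ^ i` make sense, for example `Γ = ℤ` or `Γ = ZMod 2`. -/

section Words

variable {K V B : Type*} [Field K] [AddCommGroup V] [Module K V] [AddCommGroup B] [Module K B]

/-- The linear map on a graded vector space that multiplies the elements of degree `i` by `ε i`. -/
def signMap {Γ : Type*} [DecidableEq Γ] (𝒱 : Γ → Submodule K V) [DirectSum.Decomposition 𝒱]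
    (ε : Γ → ℤˣ) : V →ₗ[K] V :=
  (DirectSum.decomposeLinearEquiv 𝒱).symm.toLinearMap ∘ₗ
    DirectSum.lmap (fun i => ((ε i : ℤ) : K) • (LinearMap.id : 𝒱 i →ₗ[K] 𝒱 i)) ∘ₗ
      (DirectSum.decomposeLinearEquiv 𝒱).toLinearMap

theorem signMap_of_mem {Γ : Type*} [DecidableEq Γ] (𝒱 : Γ → Submodule K V)
    [DirectSum.Decomposition 𝒱] (ε : Γ → ℤˣ) {i : Γ} {x : V} (hx : x ∈ 𝒱 i) :
    signMap 𝒱 ε x = ((ε i : ℤ) : K) • x := by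
  simp only [signMap, LinearMap.comp_apply, LinearEquiv.coe_coe,
    DirectSum.decomposeLinearEquiv_apply, DirectSum.decomposeLinearEquiv_symm_apply]
  rw [DirectSum.decompose_of_mem 𝒱 hx, ← DirectSum.lof_eq_of K, DirectSum.lmap_lof,
    DirectSum.lof_eq_of, DirectSum.decompose_symm_of]
  rfl

/-- `IsHomWord 𝒱 [v₁, …, vₙ] d`: the letters `vᵢ` are homogeneous and their degrees add up
to `d`. -/
inductive IsHomWord {Γ : Type*} [AddCommGroup Γ] (𝒱 : Γ → Submodule K V) : List V → Γ → Prop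
  | nil : IsHomWord 𝒱 [] 0
  | cons {a : V} {i : Γ} {l : List V} {d : Γ} (ha : a ∈ 𝒱 i) (hl : IsHomWord 𝒱 l d) :
      IsHomWord 𝒱 (a :: l) (i + d)

variable (K V B) in
/-- Linear maps from the tensor coalgebra `T V = ⨁ n, V^{⊗ n}` to `B`, given as families of
multilinear maps `Vⁿ → B` (`n ≥ 0`): the value at the word `[v₁, …, vₙ]` is the image of
`v₁ ⊗ ⋯ ⊗ vₙ`. -/
def Words : Submodule K (List V → B) where
  carrier := {f | ∀ x z : List V, IsLinearMap K fun a => f (x ++ a :: z)}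
  add_mem' {f g} hf hg x z := by
    constructor
    · intro a b
      simp only [Pi.add_apply, (hf x z).map_add, (hg x z).map_add]
      abel
    · intro c a
      simp only [Pi.add_apply, (hf x z).map_smul, (hg x z).map_smul, smul_add]
  zero_mem' x z := by constructor <;> simp
  smul_mem' c f hf x z := by
    constructor
    · intro a b
      simp only [Pi.smul_apply, (hf x z).map_add, smul_add]
    · intro c' a
      simp only [Pi.smul_apply, (hf x z).map_smul]
      rw [smul_comm]

theorem Words.map_zero (f : Words K V B) (x z : List V) : f.1 (x ++ 0 :: z) = 0 :=
  (f.2 x z).map_zero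

theorem Words.isLinearMap_map (f : Words K V B) (g : V →ₗ[K] V) (x z : List V) :
    IsLinearMap K fun a => f.1 ((x ++ a :: z).map g) := by
  simp only [List.map_append, List.map_cons]
  exact ((f.2 _ _).mk' _ ∘ₗ g).isLinear

theorem Words.ext {f g : Words K V B} (h : ∀ w, f.1 w = g.1 w) : f = g :=
  Subtype.ext (funext h)

theorem isLinearMap_comp_left {X Y Z : Type*} [AddCommGroup X] [Module K X] [AddCommGroup Y]
    [Module K Y] [AddCommGroup Z] [Module K Z] {f : V → (Y →ₗ[K] Z)} (hf : IsLinearMap K f)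
    (g : X →ₗ[K] Y) : IsLinearMap K fun a => f a ∘ₗ g :=
  ⟨fun a b => by rw [hf.map_add, LinearMap.add_comp],
    fun c a => by rw [hf.map_smul, LinearMap.smul_comp]⟩

theorem isLinearMap_comp_right {X Y Z : Type*} [AddCommGroup X] [Module K X] [AddCommGroup Y]
    [Module K Y] [AddCommGroup Z] [Module K Z] {f : V → (X →ₗ[K] Y)} (hf : IsLinearMap K f)
    (g : Y →ₗ[K] Z) : IsLinearMap K fun a => g ∘ₗ f a :=
  ⟨fun a b => by rw [hf.map_add, LinearMap.comp_add],
    fun c a => by rw [hf.map_smul, LinearMap.comp_smul]⟩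

theorem IsHomWord.split {Γ : Type*} [AddCommGroup Γ] {𝒱 : Γ → Submodule K V} :
    ∀ {x y : List V} {d : Γ}, IsHomWord 𝒱 (x ++ y) d →
      ∃ d₁ d₂, IsHomWord 𝒱 x d₁ ∧ IsHomWord 𝒱 y d₂ ∧ d₁ + d₂ = d
  | [], _, d, h => ⟨0, d, .nil, h, zero_add d⟩
  | _ :: _, _, _, .cons (i := i) ha hl => by
    obtain ⟨d₁, d₂, h₁, h₂, h⟩ := hl.split
    exact ⟨i + d₁, d₂, .cons ha h₁, h₂, by rw [add_assoc, h]⟩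

theorem IsHomWord.append {Γ : Type*} [AddCommGroup Γ] {𝒱 : Γ → Submodule K V} {x y : List V}
    {d₁ d₂ : Γ} (hx : IsHomWord 𝒱 x d₁) (hy : IsHomWord 𝒱 y d₂) :
    IsHomWord 𝒱 (x ++ y) (d₁ + d₂) := by
  induction hx with
  | nil => simpa using hy
  | cons ha _ ih => rw [add_assoc]; exact .cons ha ih

theorem IsHomWord.map {Γ : Type*} [AddCommGroup Γ] {𝒱 : Γ → Submodule K V} {x : List V} {d : Γ}
    (hx : IsHomWord 𝒱 x d) (g : V → V) (hg : ∀ i, ∀ a ∈ 𝒱 i, g a ∈ 𝒱 i) :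
    IsHomWord 𝒱 (x.map g) d := by
  induction hx with
  | nil => exact .nil
  | cons ha _ ih => exact .cons (hg _ _ ha) ih

end Words

section Split

variable {V B : Type*} [AddCommGroup B]

/-- Sum over all deconcatenations `w = x ++ y` (`x` or `y` may be empty), that is, evaluation of
`G` on the comultiplication `Δ w = ∑ x ⊗ y` of the tensor coalgebra. -/
def splitSum (G : List V → List V → B) (w : List V) : B :=
  ∑ i ∈ Finset.range (w.length + 1), G (w.take i) (w.drop i)

/-- Sum over all factorisations `w = x ++ y ++ z` of a word into three (possibly empty) words. -/
def splitSum₃ (G : List V → List V → List V → B) (w : List V) : B :=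
  splitSum (fun x r => splitSum (fun y z => G x y z) r) w

theorem splitSum_nil (G : List V → List V → B) : splitSum G [] = G [] [] := by
  simp [splitSum]

theorem splitSum_append_cons (G : List V → List V → B) (x z : List V) (a : V) :
    splitSum G (x ++ a :: z) =
      splitSum (fun p q => G p (q ++ a :: z)) x + splitSum (fun p q => G (x ++ a :: p) q) z := by
  unfold splitSum
  have h : (x ++ a :: z).length + 1 = (x.length + 1) + (z.length + 1) := by
    simp; omega
  rw [h, Finset.sum_range_add]
  congr 1
  · refine Finset.sum_congr rfl fun i hi => ?_
    have hi' : i ≤ x.length := by simpa [Nat.lt_succ_iff] using hi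
    rw [List.take_append_of_le_length hi', List.drop_append_of_le_length hi']
  · refine Finset.sum_congr rfl fun i _ => ?_
    have e : x.length + 1 + i = x.length + (i + 1) := by omega
    rw [e, List.take_length_add_append, List.drop_length_add_append]
    simp

theorem splitSum_cons (G : List V → List V → B) (a : V) (z : List V) :
    splitSum G (a :: z) = G [] (a :: z) + splitSum (fun p q => G (a :: p) q) z := by
  simpa [splitSum_nil] using splitSum_append_cons G [] z a

theorem splitSum_concat (G : List V → List V → B) (x : List V) (a : V) :
    splitSum G (x ++ [a]) = splitSum (fun p q => G p (q ++ [a])) x + G (x ++ [a]) [] := by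
  simpa [splitSum_nil] using splitSum_append_cons G x [] a

theorem splitSum_zero (w : List V) : splitSum (fun _ _ => (0 : B)) w = 0 := by
  simp [splitSum]

theorem splitSum_eq_first {G : List V → List V → B} (w : List V)
    (h : ∀ a p q, G (a :: p) q = 0) : splitSum G w = G [] w := by
  cases w with
  | nil => exact splitSum_nil G
  | cons a z => simp only [splitSum_cons, h, splitSum_zero, add_zero]

theorem splitSum_eq_last {G : List V → List V → B} (w : List V)
    (h : ∀ p q, q ≠ [] → G p q = 0) : splitSum G w = G w [] := by
  rcases List.eq_nil_or_concat w with rfl | ⟨x, a, rfl⟩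
  · exact splitSum_nil G
  · rw [List.concat_eq_append, splitSum_concat]
    simp [h, splitSum_zero]

theorem map_splitSum {C F : Type*} [AddCommGroup C] [FunLike F B C] [AddMonoidHomClass F B C] (f : F)
    (G : List V → List V → B) (w : List V) :
    f (splitSum G w) = splitSum (fun x y => f (G x y)) w := by
  simp [splitSum, map_sum]

theorem splitSum_add (G H : List V → List V → B) (w : List V) :
    splitSum (fun x y => G x y + H x y) w = splitSum G w + splitSum H w := by
  simp [splitSum, Finset.sum_add_distrib]

theorem splitSum_smul {K : Type*} [Field K] [Module K B] (c : K) (G : List V → List V → B)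
    (w : List V) : splitSum (fun x y => c • G x y) w = c • splitSum G w := by
  simp [splitSum, Finset.smul_sum]

theorem splitSum_eq_zero {G : List V → List V → B} {w : List V}
    (h : ∀ x y, x ++ y = w → G x y = 0) : splitSum G w = 0 :=
  Finset.sum_eq_zero fun _ _ => h _ _ (List.take_append_drop _ _)

theorem splitSum_mem {K : Type*} [Field K] [Module K B] {S : Submodule K B}
    {G : List V → List V → B} {w : List V}
    (h : ∀ x y, x ++ y = w → G x y ∈ S) : splitSum G w ∈ S :=
  Submodule.sum_mem _ fun _ _ => h _ _ (List.take_append_drop _ _)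

theorem splitSum_isLinearMap {K : Type*} [Field K] [Module K B] [AddCommGroup V] [Module K V]
    {G : List V → List V → B}
    (h₁ : ∀ x z y, IsLinearMap K fun a => G (x ++ a :: z) y)
    (h₂ : ∀ y x z, IsLinearMap K fun a => G y (x ++ a :: z)) (x z : List V) :
    IsLinearMap K fun a => splitSum G (x ++ a :: z) := by
  simp only [splitSum_append_cons]
  constructor
  · intro a b
    simp only [(h₁ _ _ _).map_add, (h₂ _ _ _).map_add, splitSum_add]
    abel
  · intro c a
    simp only [(h₁ _ _ _).map_smul, (h₂ _ _ _).map_smul, splitSum_smul, smul_add]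

theorem splitSum_isLinearMap_param {K W : Type*} [Field K] [Module K B] [AddCommGroup W]
    [Module K W] {G : W → List V → List V → B} (w : List V)
    (h : ∀ x y, IsLinearMap K fun a => G a x y) : IsLinearMap K fun a => splitSum (G a) w := by
  constructor
  · intro a b
    rw [← splitSum_add]
    exact congrArg (splitSum · w) (funext₂ fun x y => (h x y).map_add a b)
  · intro c a
    rw [← splitSum_smul]
    exact congrArg (splitSum · w) (funext₂ fun x y => (h x y).map_smul c a)

end Split

/-! ### `A_∞`-algebras and modules -/

/-- A strictly unital `A_∞`-algebra `A` over the field `K`. The structure maps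
`μⁿ : (sA)^{⊗ n} → sA`, `n ≥ 1`, have degree one for the shifted grading `(sA)^i = A^{i+1}`. -/
structure AInfAlgebra (K Γ : Type*) [Field K] [CommRing Γ] [DecidableEq Γ]
    [Module Γ (Additive ℤˣ)] where
  carrier : Type*
  [addCommGroup : AddCommGroup carrier]
  [module : Module K carrier]
  /-- the grading of `A` -/
  gr : Γ → Submodule K carrier
  [decomposition : DirectSum.Decomposition gr]
  /-- `μ [a₁, …, aₙ] = μⁿ (a₁ ⊗ ⋯ ⊗ aₙ)` -/
  μ : Words K carrier carrier
  /-- there is no `μ⁰` -/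
  μ_nil : μ.1 [] = 0
  μ_degree : ∀ w d, IsHomWord (fun i => gr (i + 1)) w d → μ.1 w ∈ gr (d + 1 + 1)
  /-- `∑ μ ∘ (1 ⊗ μ ⊗ 1) = 0`; moving the inner `μ`, of degree one, past `x` gives the Koszul
  sign `(-1) ^ |x|`, where `|·|` is the degree in `sA`. -/
  relation : ∀ w, splitSum₃ (fun x y z =>
    μ.1 (x.map (signMap gr fun i => (-1 : ℤˣ) ^ (i - 1)) ++ μ.1 y :: z)) w = 0
  /-- the strict unit, of degree `0` in `A` and degree `-1` in `sA` -/
  e : carrier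
  e_mem : e ∈ gr 0
  unit_left : ∀ a, μ.1 [e, a] = a
  /-- `-μ² ∘ (1 ⊗ e) = 1`, where `(1 ⊗ e) (a) = (-1) ^ |a| a ⊗ e` as `e` has degree `-1` -/
  unit_right : ∀ a, μ.1 [a, e] = -signMap gr (fun i => (-1 : ℤˣ) ^ (i - 1)) a
  unit_vanish : ∀ x z : List carrier, x.length + z.length ≠ 1 → μ.1 (x ++ e :: z) = 0

attribute [instance] AInfAlgebra.addCommGroup AInfAlgebra.module AInfAlgebra.decomposition

variable {K Γ : Type*} [Field K] [CommRing Γ] [DecidableEq Γ] [Module Γ (Additive ℤˣ)]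

/-- The grading `(sA)^i = A^{i+1}` of the shift of `A`. -/
def AInfAlgebra.sgr (A : AInfAlgebra K Γ) (i : Γ) : Submodule K A.carrier := A.gr (i + 1)

/-- The Koszul sign of moving a map of degree `k` past an element of `sA`: multiplication by
`(-1) ^ (k * i)` on `(sA)^i`. -/
def AInfAlgebra.kos (A : AInfAlgebra K Γ) (k : Γ) : A.carrier →ₗ[K] A.carrier :=
  signMap A.gr fun i => (-1 : ℤˣ) ^ (k * (i - 1))

theorem AInfAlgebra.kos_mem (A : AInfAlgebra K Γ) (k i : Γ) (a : A.carrier) (ha : a ∈ A.sgr i) :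
    A.kos k a ∈ A.sgr i := by
  rw [AInfAlgebra.kos, signMap_of_mem A.gr _ ha]
  exact Submodule.smul_mem _ _ ha

theorem AInfAlgebra.unit_right' (A : AInfAlgebra K Γ) (a : A.carrier) :
    A.μ.1 [a, A.e] = -A.kos 1 a := by
  simp only [A.unit_right, AInfAlgebra.kos, one_mul]

theorem AInfAlgebra.kos_e (A : AInfAlgebra K Γ) (k : Γ) :
    A.kos k A.e = ((((-1 : ℤˣ) ^ k : ℤˣ) : ℤ) : K) • A.e := by
  rw [AInfAlgebra.kos, signMap_of_mem A.gr _ A.e_mem, zero_sub, mul_neg, mul_one, uzpow_neg,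
    Int.units_inv_eq_self]

/-- A (strictly unital, left) `A_∞`-module over `A`: a graded vector space `M` with a map
`μ_M : T(sA) ⊗ M → M` of degree one. -/
structure AInfModule (A : AInfAlgebra K Γ) where
  carrier : Type*
  [addCommGroup : AddCommGroup carrier]
  [module : Module K carrier]
  gr : Γ → Submodule K carrier
  [decomposition : DirectSum.Decomposition gr]
  /-- `μ [a₁, …, aₙ] m = μ_M (a₁ ⊗ ⋯ ⊗ aₙ ⊗ m)`; in particular `μ []` is the differential. -/
  μ : Words K A.carrier (carrier →ₗ[K] carrier)
  μ_degree : ∀ w d, IsHomWord A.sgr w d → ∀ j, ∀ m ∈ gr j, μ.1 w m ∈ gr (d + j + 1)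
  /-- `μ_M ∘ (1 ⊗ μ_M) ∘ Δ + μ_M ∘ (b_A ⊗ 1) = 0` -/
  relation : ∀ w, splitSum (fun x y => μ.1 (x.map (A.kos 1)) ∘ₗ μ.1 y) w +
    splitSum₃ (fun x y z => μ.1 (x.map (A.kos 1) ++ A.μ.1 y :: z)) w = 0
  unit : μ.1 [A.e] = LinearMap.id
  unit_vanish : ∀ x z : List A.carrier, x.length + z.length ≠ 0 → μ.1 (x ++ A.e :: z) = 0

attribute [instance] AInfModule.addCommGroup AInfModule.module AInfModule.decomposition

variable {A : AInfAlgebra K Γ}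

/-- The differential `μ_M⁰` of the complex underlying `M`. -/
def AInfModule.d (M : AInfModule A) : M.carrier →ₗ[K] M.carrier := M.μ.1 []

theorem AInfModule.d_d (M : AInfModule A) (m : M.carrier) : M.d (M.d m) = 0 := by
  have h := M.relation []
  have h0 := Words.map_zero M.μ [] []
  simp only [List.nil_append] at h0
  simp only [splitSum₃, splitSum_nil, List.map_nil, List.nil_append, A.μ_nil, h0, add_zero] at h
  exact LinearMap.congr_fun h m

/-! ### The complex of morphisms and its length filtration -/

section Hom

variable (M N : AInfModule A)

/-- The differential on morphisms of degree `k`, before imposing any degree or unit condition: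
`d φ = φ ∘ (1 ⊗ μ_M) ∘ Δ + φ ∘ (b_A ⊗ 1) - (-1) ^ k • μ_N ∘ (1 ⊗ φ) ∘ Δ`. -/
def preDFun (k : Γ) (φ : Words K A.carrier (M.carrier →ₗ[K] N.carrier)) (w : List A.carrier) :
    M.carrier →ₗ[K] N.carrier :=
  splitSum (fun x y => φ.1 (x.map (A.kos 1)) ∘ₗ M.μ.1 y) w +
  splitSum₃ (fun x y z => φ.1 (x.map (A.kos 1) ++ A.μ.1 y :: z)) w -
  ((((-1 : ℤˣ) ^ k : ℤˣ) : ℤ) : K) • splitSum (fun x y => N.μ.1 (x.map (A.kos k)) ∘ₗ φ.1 y) w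

theorem preDFun_mem (k : Γ) (φ : Words K A.carrier (M.carrier →ₗ[K] N.carrier)) :
    preDFun M N k φ ∈ Words K A.carrier (M.carrier →ₗ[K] N.carrier) := by
  intro x z
  have h₁ : IsLinearMap K fun a =>
      splitSum (fun x y => φ.1 (x.map (A.kos 1)) ∘ₗ M.μ.1 y) (x ++ a :: z) :=
    splitSum_isLinearMap (fun _ _ _ => isLinearMap_comp_left (Words.isLinearMap_map φ _ _ _) _)
      (fun _ _ _ => isLinearMap_comp_right (M.μ.2 _ _) _) x z
  have h₂ : IsLinearMap K fun a =>
      splitSum₃ (fun x y z => φ.1 (x.map (A.kos 1) ++ A.μ.1 y :: z)) (x ++ a :: z) := by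
    refine splitSum_isLinearMap (fun x' z' r => ?_) (fun x' p q => ?_) x z
    · refine splitSum_isLinearMap_param r fun y z => ?_
      simp only [List.map_append, List.map_cons, List.append_assoc, List.cons_append]
      exact ((φ.2 _ _).mk' _ ∘ₗ A.kos 1).isLinear
    · refine splitSum_isLinearMap (fun x₁ z₁ y₁ => ?_) (fun y₁ x₁ z₁ => ?_) p q
      · exact ((φ.2 _ _).mk' _ ∘ₗ (A.μ.2 x₁ z₁).mk' _).isLinear
      · have := φ.2 (x'.map (A.kos 1) ++ A.μ.1 y₁ :: x₁) z₁
        simpa only [List.append_assoc, List.cons_append] using this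
  have h₃ : IsLinearMap K fun a =>
      splitSum (fun x y => N.μ.1 (x.map (A.kos k)) ∘ₗ φ.1 y) (x ++ a :: z) :=
    splitSum_isLinearMap (fun _ _ _ => isLinearMap_comp_left (Words.isLinearMap_map N.μ _ _ _) _)
      (fun _ _ _ => isLinearMap_comp_right (φ.2 _ _) _) x z
  exact (h₁.mk' _ + h₂.mk' _ - ((((-1 : ℤˣ) ^ k : ℤˣ) : ℤ) : K) • h₃.mk' _).isLinear

/-- `preDFun` as a linear map. -/
def preD (k : Γ) : Words K A.carrier (M.carrier →ₗ[K] N.carrier) →ₗ[K]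
    Words K A.carrier (M.carrier →ₗ[K] N.carrier) where
  toFun φ := ⟨preDFun M N k φ, preDFun_mem M N k φ⟩
  map_add' φ ψ := by
    refine Words.ext fun w => ?_
    change preDFun M N k (φ + ψ) w = preDFun M N k φ w + preDFun M N k ψ w
    have e : ∀ v, (φ + ψ).1 v = φ.1 v + ψ.1 v := fun _ => rfl
    simp only [preDFun, splitSum₃, e, LinearMap.add_comp, LinearMap.comp_add, splitSum_add,
      smul_add]
    abel
  map_smul' c φ := by
    refine Words.ext fun w => ?_
    change preDFun M N k (c • φ) w = c • preDFun M N k φ w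
    have e : ∀ v, (c • φ).1 v = c • φ.1 v := fun _ => rfl
    simp only [preDFun, splitSum₃, e, LinearMap.smul_comp, LinearMap.comp_smul, splitSum_smul,
      smul_sub, smul_add]
    rw [smul_comm c]

/-- `Hom^k(M, N)`: the strictly unital morphisms `φ : T(sA) ⊗ M → N` of degree `k`. -/
def HomDeg (k : Γ) : Submodule K (Words K A.carrier (M.carrier →ₗ[K] N.carrier)) where
  carrier := {φ | (∀ w d, IsHomWord A.sgr w d → ∀ j, ∀ m ∈ M.gr j, φ.1 w m ∈ N.gr (d + j + k)) ∧
    ∀ x z, φ.1 (x ++ A.e :: z) = 0}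
  add_mem' {φ ψ} hφ hψ := ⟨fun w d hw j m hm =>
      add_mem (hφ.1 w d hw j m hm) (hψ.1 w d hw j m hm),
    fun x z => by
      change φ.1 _ + ψ.1 _ = 0
      rw [hφ.2 x z, hψ.2 x z, add_zero]⟩
  zero_mem' := ⟨fun w d hw j m hm => zero_mem _, fun x z => rfl⟩
  smul_mem' c φ hφ := ⟨fun w d hw j m hm => Submodule.smul_mem _ c (hφ.1 w d hw j m hm),
    fun x z => by
      change c • φ.1 _ = 0
      rw [hφ.2 x z, smul_zero]⟩

theorem preDFun_degree (k : Γ) (φ : Words K A.carrier (M.carrier →ₗ[K] N.carrier))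
    (hφ : φ ∈ HomDeg M N k) (w : List A.carrier) (d : Γ) (hw : IsHomWord A.sgr w d) (j : Γ)
    (m : M.carrier) (hm : m ∈ M.gr j) : preDFun M N k φ w m ∈ N.gr (d + j + (k + 1)) := by
  have ev : ∀ (G : List A.carrier → List A.carrier → (M.carrier →ₗ[K] N.carrier))
      (w : List A.carrier), splitSum G w m = splitSum (fun x y => G x y m) w := fun G w =>
    map_splitSum (LinearMap.applyₗ (R := K) m) G w
  simp only [preDFun, splitSum₃, LinearMap.sub_apply, LinearMap.add_apply, LinearMap.smul_apply, ev]
  refine sub_mem (add_mem ?_ ?_) (Submodule.smul_mem _ _ ?_)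
  · refine splitSum_mem fun x y hxy => ?_
    subst hxy
    obtain ⟨d₁, d₂, h₁, h₂, rfl⟩ := hw.split
    have := hφ.1 _ _ (h₁.map _ (A.kos_mem 1)) _ _ (M.μ_degree _ _ h₂ _ _ hm)
    rwa [show d₁ + d₂ + j + (k + 1) = d₁ + (d₂ + j + 1) + k by ring]
  · refine splitSum_mem fun x r hxr => splitSum_mem fun y z hyz => ?_
    subst hxr hyz
    obtain ⟨d₁, _, h₁, h', rfl⟩ := hw.split
    obtain ⟨d₂, d₃, h₂, h₃, rfl⟩ := h'.split
    have := hφ.1 _ _ ((h₁.map _ (A.kos_mem 1)).append (.cons (A.μ_degree _ _ h₂) h₃)) _ _ hm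
    rwa [show d₁ + (d₂ + d₃) + j + (k + 1) = d₁ + (d₂ + 1 + d₃) + j + k by ring]
  · refine splitSum_mem fun x y hxy => ?_
    subst hxy
    obtain ⟨d₁, d₂, h₁, h₂, rfl⟩ := hw.split
    have := N.μ_degree _ _ (h₁.map _ (A.kos_mem k)) _ _ (hφ.1 _ _ h₂ _ _ hm)
    rwa [show d₁ + d₂ + j + (k + 1) = d₁ + (d₂ + j + k) + 1 by ring]

theorem preDFun_unit (k : Γ) (φ : Words K A.carrier (M.carrier →ₗ[K] N.carrier))
    (hφ : φ ∈ HomDeg M N k) (x z : List A.carrier) : preDFun M N k φ (x ++ A.e :: z) = 0 := by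
  have hs : ∀ c : K, ∀ x z, φ.1 (x ++ c • A.e :: z) = 0 := fun c x z => by
    rw [(φ.2 x z).map_smul, hφ.2, smul_zero]
  have hs' : ∀ x z, φ.1 ((x ++ A.e :: z).map (A.kos 1)) = 0 := fun x z => by
    rw [List.map_append, List.map_cons, A.kos_e, hs]
  have hsl : ∀ x y z v, φ.1 ((x ++ A.e :: y).map (A.kos 1) ++ v :: z) = 0 := fun x y z v => by
    rw [List.map_append, List.map_cons, A.kos_e, List.append_assoc, List.cons_append, hs]
  have hsr : ∀ x y z v, φ.1 (x ++ v :: (y ++ A.e :: z)) = 0 := fun x y z v => by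
    simpa using hφ.2 (x ++ v :: y) z
  -- the term `φ ∘ (1 ⊗ μ_M) ∘ Δ`
  have t₁ : splitSum (fun x y => φ.1 (x.map (A.kos 1)) ∘ₗ M.μ.1 y) (x ++ A.e :: z) =
      φ.1 (x.map (A.kos 1)) ∘ₗ M.μ.1 (A.e :: z) := by
    rw [splitSum_append_cons]
    simp only [hs', LinearMap.zero_comp, splitSum_zero, add_zero]
    rw [splitSum_eq_last]
    · rfl
    · intro p q hq
      rw [M.unit_vanish q z (by have := List.length_pos_iff.2 hq; omega), LinearMap.comp_zero]
  -- the term `φ ∘ (b_A ⊗ 1)`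
  have t₂ : splitSum₃ (fun x y z => φ.1 (x.map (A.kos 1) ++ A.μ.1 y :: z)) (x ++ A.e :: z) =
      splitSum (fun p q => splitSum
        (fun a b => φ.1 (p.map (A.kos 1) ++ A.μ.1 (q ++ A.e :: a) :: b)) z) x := by
    rw [splitSum₃, splitSum_append_cons]
    simp only [hsl, splitSum_zero, add_zero, splitSum_append_cons, hsr, zero_add]
  -- the term `μ_N ∘ (1 ⊗ φ) ∘ Δ`
  have t₃ : splitSum (fun x y => N.μ.1 (x.map (A.kos k)) ∘ₗ φ.1 y) (x ++ A.e :: z) =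
      ((((-1 : ℤˣ) ^ k : ℤˣ) : ℤ) : K) • (N.μ.1 (x.map (A.kos k) ++ [A.e]) ∘ₗ φ.1 z) := by
    rw [splitSum_append_cons]
    simp only [hφ.2, LinearMap.comp_zero, splitSum_zero, zero_add]
    simp only [List.map_append, List.map_cons, A.kos_e, (N.μ.2 _ _).map_smul]
    rw [splitSum_eq_first]
    · rfl
    · intro a p q
      rw [N.unit_vanish _ _ (by simp), smul_zero, LinearMap.zero_comp]
  have hk : ((((-1 : ℤˣ) ^ k : ℤˣ) : ℤ) : K) * ((((-1 : ℤˣ) ^ k : ℤˣ) : ℤ) : K) = 1 := by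
    rw [← Int.cast_mul, ← Units.val_mul, Int.units_mul_self]
    simp
  have u₁ : ∀ y : List A.carrier, y.length ≠ 1 → A.μ.1 (A.e :: y) = 0 := fun y hy =>
    A.unit_vanish [] y (by simpa using hy)
  have u₂ : ∀ (q : List A.carrier) (c : A.carrier) (y : List A.carrier), q ≠ [] ∨ y ≠ [] →
      A.μ.1 (q ++ c :: A.e :: y) = 0 := fun q c y h => by
    have := A.unit_vanish (q ++ [c]) y (by
      rcases h with h | h <;> have := List.length_pos_iff.2 h <;> simp <;> omega)
    simpa using this
  have key : ∀ v, φ.1 v ∘ₗ M.μ.1 (A.e :: z) +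
      splitSum (fun a b => φ.1 (v ++ A.μ.1 (A.e :: a) :: b)) z = φ.1 (v ++ z) := by
    intro v
    cases z with
    | nil =>
      rw [splitSum_nil, u₁ _ (by simp), Words.map_zero, M.unit]
      simp
    | cons c z =>
      rw [splitSum_cons, u₁ _ (by simp), Words.map_zero, zero_add, splitSum_eq_first, A.unit_left]
      · have := M.unit_vanish [] (c :: z) (by simp)
        rw [List.nil_append] at this
        rw [this, LinearMap.comp_zero, zero_add]
      · intro a p q
        rw [u₁ _ (by simp), Words.map_zero]
  rw [preDFun, t₁, t₂, t₃, smul_smul, hk, one_smul]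
  rcases List.eq_nil_or_concat x with rfl | ⟨x, c, rfl⟩
  · have := key []
    rw [List.nil_append] at this
    simp only [splitSum_nil, List.map_nil, List.nil_append] at this ⊢
    rw [this, N.unit, LinearMap.id_comp, sub_self]
  · rw [List.concat_eq_append, splitSum_concat]
    simp only [List.nil_append, List.append_assoc, List.cons_append]
    rw [splitSum_eq_last, splitSum_eq_first]
    · rw [add_left_comm, key, List.nil_append, A.unit_right', N.unit_vanish _ _ (by simp),
        LinearMap.zero_comp, sub_zero]
      rw [← neg_one_smul K, (φ.2 _ _).map_smul, neg_one_smul]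
      simp
    · intro a p q
      rw [u₂ _ _ _ (by simp), Words.map_zero]
    · intro p q hq
      simp only [u₂ q c _ (Or.inl hq), Words.map_zero, splitSum_zero]

theorem preD_mem (k : Γ) (φ : Words K A.carrier (M.carrier →ₗ[K] N.carrier))
    (hφ : φ ∈ HomDeg M N k) : preD M N k φ ∈ HomDeg M N (k + 1) :=
  ⟨preDFun_degree M N k φ hφ, preDFun_unit M N k φ hφ⟩

/-- The differential `Hom^k(M, N) → Hom^{k+1}(M, N)`. -/
def homD (k : Γ) : HomDeg M N k →ₗ[K] HomDeg M N (k + 1) :=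
  (preD M N k).restrict (preD_mem M N k)

/-- The length filtration: `F^q Hom^k(M, N)` consists of the morphisms that vanish on
`(sA)^{⊗ i} ⊗ M` for all `i < q`. -/
def lengthFil (q : ℕ) (k : Γ) : Submodule K (HomDeg M N k) where
  carrier := {φ | ∀ w : List A.carrier, w.length < q → φ.1.1 w = 0}
  add_mem' {φ ψ} hφ hψ w hw := by simp [hφ w hw, hψ w hw]
  zero_mem' w hw := rfl
  smul_mem' c φ hφ w hw := by simp [hφ w hw]

end Hom

/-! ### Filtered complexes: length and spectral sequence -/

/-- A filtered cochain complex: a vector space `V` (the sum of its graded pieces) with a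
differential `d` and an increasing filtration by subcomplexes `G k`, `k ∈ ℤ`. -/
structure FilteredComplex (K : Type*) [Field K] where
  V : Type*
  [addCommGroup : AddCommGroup V]
  [module : Module K V]
  d : V →ₗ[K] V
  d_d : ∀ x, d (d x) = 0
  G : ℤ → Submodule K V
  mono : Monotone G
  d_mem : ∀ k, ∀ x ∈ G k, d x ∈ G k

attribute [instance] FilteredComplex.addCommGroup FilteredComplex.module

namespace FilteredComplex

variable (C : FilteredComplex K)

/-- The cohomology `H(C) = ker d / im d`. -/
abbrev H : Type _ := LinearMap.ker C.d ⧸ (LinearMap.range C.d).submoduleOf (LinearMap.ker C.d)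

/-- `H(C)_k`, the image in `H(C)` of the cocycles that lie in `G k`. -/
def filH (k : ℤ) : Submodule K C.H :=
  ((C.G k).submoduleOf (LinearMap.ker C.d)).map (Submodule.mkQ _)

/-- `ℓ₊ = inf {k | H(C)_k = H(C)}`, which is `∞` if there is no such `k`. -/
def lengthPlus : EReal := sInf {x | ∃ k : ℤ, x = ((k : ℝ) : EReal) ∧ C.filH k = ⊤}

/-- `ℓ₋ = inf {k | H(C)_k ≠ 0}`, which is `-∞` if `H(C)_k ≠ 0` for arbitrarily small `k`. -/
def lengthMinus : EReal := sInf {x | ∃ k : ℤ, x = ((k : ℝ) : EReal) ∧ C.filH k ≠ ⊥}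

open Classical in
/-- The length `ℓ = max (|ℓ₊|, |ℓ₋|)` of a filtered complex. By convention, an acyclic complex has
length `0`. -/
def length : ℝ≥0∞ :=
  if Subsingleton C.H then 0 else max C.lengthPlus.abs C.lengthMinus.abs

/-- `Z^r_k = {c ∈ G k | d c ∈ G (k - r)}`. -/
def Z (r k : ℤ) : Submodule K C.V := C.G k ⊓ (C.G (k - r)).comap C.d

/-- `B^r_k = Z^{r-1}_{k-1} + d (Z^{r-1}_{k+r-1})`. -/
def B (r k : ℤ) : Submodule K C.V :=
  C.Z (r - 1) (k - 1) ⊔ (C.Z (r - 1) (k + r - 1)).map C.d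

/-- The page `E^r_k = Z^r_k / B^r_k` of the spectral sequence of the filtration, a subquotient of
`G k / G (k - 1)`. -/
abbrev Page (r k : ℤ) : Type _ := C.Z r k ⧸ (C.B r k).submoduleOf (C.Z r k)

/-- The differential `d_r : E^r_k → E^r_{k-r}`, `[c] ↦ [d c]`. -/
def pageD (r k : ℤ) : C.Page r k →ₗ[K] C.Page r (k - r) :=
  Submodule.mapQ _ _ (C.d.restrict (p := C.Z r k) (q := C.Z r (k - r)) fun c hc =>
      ⟨hc.2, by simp [C.d_d]⟩) <| by
    intro c hc
    have hc' : (c : C.V) ∈ C.B r k := hc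
    change C.d c ∈ C.B r (k - r)
    obtain ⟨y, hy, _, ⟨z, _, rfl⟩, h⟩ := Submodule.mem_sup.1 hc'
    rw [← h, map_add, C.d_d, add_zero]
    refine Submodule.mem_sup_right (Submodule.mem_map_of_mem ?_)
    rwa [show k - r + r - 1 = k - 1 by ring]

/-- The spectral sequence degenerates at the page `r₀`: all differentials `d_r` with `r ≥ r₀`
vanish, that is, `E^{r₀} = E^∞`. -/
def DegeneratesAt (r₀ : ℤ) : Prop := ∀ r, r₀ ≤ r → ∀ k, C.pageD r k = 0

end FilteredComplex

/-! ### Filtered modules and their quotients -/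

/-- An increasing filtration of the `A_∞`-module `N` by graded submodules `G k`, `k ∈ ℤ`. -/
structure Filtration (N : AInfModule A) where
  G : ℤ → Submodule K N.carrier
  mono : Monotone G
  homogeneous : ∀ k, ∀ x ∈ G k, ∀ i, (DirectSum.decompose N.gr x i : N.carrier) ∈ G k
  μ_mem : ∀ k w, ∀ x ∈ G k, N.μ.1 w x ∈ G k

namespace Filtration

variable {N : AInfModule A} (G : Filtration N)

/-- The filtered complex underlying a filtered module. -/
def complex : FilteredComplex K where
  V := N.carrier
  d := N.d
  d_d := N.d_d
  G := G.G
  mono := G.mono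
  d_mem k x hx := G.μ_mem k [] x hx

/-- The grading of `N / G t`. -/
def quotientGr (t : ℤ) (i : Γ) : Submodule K (N.carrier ⧸ G.G t) := (N.gr i).map (G.G t).mkQ

/-- The decomposition of a class of `N / G t` into homogeneous classes, as a map on `N`. -/
def quotientDecompose (t : ℤ) : N.carrier →ₗ[K] ⨁ i, G.quotientGr t i :=
  DirectSum.lmap (fun i => (G.G t).mkQ.restrict (p := N.gr i) (q := G.quotientGr t i)
    fun _ hx => Submodule.mem_map_of_mem hx) ∘ₗ (DirectSum.decomposeLinearEquiv N.gr).toLinearMap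

theorem quotientDecompose_of_mem (t : ℤ) {i : Γ} {x : N.carrier} (hx : x ∈ N.gr i) :
    G.quotientDecompose t x = DirectSum.lof K Γ (fun i => G.quotientGr t i) i
      ⟨(G.G t).mkQ x, Submodule.mem_map_of_mem hx⟩ := by
  rw [quotientDecompose, LinearMap.comp_apply, LinearEquiv.coe_coe,
    DirectSum.decomposeLinearEquiv_apply, DirectSum.decompose_of_mem N.gr hx,
    ← DirectSum.lof_eq_of K, DirectSum.lmap_lof]
  rfl

theorem quotientDecompose_eq_zero (t : ℤ) : G.G t ≤ LinearMap.ker (G.quotientDecompose t) := by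
  intro x hx
  refine DFinsupp.ext fun i => Subtype.ext ?_
  change (G.G t).mkQ (DirectSum.decompose N.gr x i : N.carrier) = 0
  rw [Submodule.mkQ_apply, Submodule.Quotient.mk_eq_zero]
  exact G.homogeneous t x hx i

theorem coe_quotientDecompose (t : ℤ) (x : N.carrier) :
    DirectSum.coeAddMonoidHom (G.quotientGr t) (G.quotientDecompose t x) = (G.G t).mkQ x := by
  induction x using DirectSum.Decomposition.inductionOn N.gr with
  | zero => simp only [map_zero]
  | homogeneous m =>
    rw [G.quotientDecompose_of_mem t m.2, DirectSum.lof_eq_of, DirectSum.coeAddMonoidHom_of]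
  | add m m' h h' => rw [map_add, map_add, h, h', map_add]

theorem quotientDecompose_surjective (t : ℤ) : Function.Surjective (G.quotientDecompose t) := by
  intro y
  induction y using DirectSum.induction_on with
  | zero => exact ⟨0, map_zero _⟩
  | of i y =>
    obtain ⟨_, x, hx, rfl⟩ := y
    exact ⟨x, G.quotientDecompose_of_mem t hx⟩
  | add y y' h h' =>
    obtain ⟨x, rfl⟩ := h
    obtain ⟨x', rfl⟩ := h'
    exact ⟨x + x', map_add _ _ _⟩

instance quotientDecomposition (t : ℤ) : DirectSum.Decomposition (G.quotientGr t) where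
  decompose' y := G.quotientDecompose t (Function.surjInv (G.G t).mkQ_surjective y)
  left_inv y := by
    rw [coe_quotientDecompose]
    exact Function.surjInv_eq _ y
  right_inv y := by
    obtain ⟨x, rfl⟩ := G.quotientDecompose_surjective t y
    rw [coe_quotientDecompose]
    refine sub_eq_zero.1 ((map_sub (G.quotientDecompose t) _ x).symm.trans
      (G.quotientDecompose_eq_zero t ?_))
    refine (Submodule.Quotient.eq (G.G t)).1 ?_
    exact Function.surjInv_eq (G.G t).mkQ_surjective _

/-- The quotient module `N_t = N / G t`. -/
abbrev quotient (t : ℤ) : AInfModule A where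
  carrier := N.carrier ⧸ G.G t
  gr := G.quotientGr t
  μ := ⟨fun w => (G.G t).mapQ (G.G t) (N.μ.1 w) (G.μ_mem t w), fun x z => by
    constructor
    · intro a b
      refine Submodule.linearMap_qext _ (LinearMap.ext fun m => ?_)
      simp [(N.μ.2 x z).map_add]
    · intro c a
      refine Submodule.linearMap_qext _ (LinearMap.ext fun m => ?_)
      simp [(N.μ.2 x z).map_smul]⟩
  μ_degree := by
    rintro w d hw j _ ⟨m, hm, rfl⟩
    exact Submodule.mem_map_of_mem (N.μ_degree w d hw j m hm)
  relation w := by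
    refine Submodule.linearMap_qext _ (LinearMap.ext fun m => ?_)
    have h := congrArg (G.G t).mkQ (LinearMap.congr_fun (N.relation w) m)
    simp only [splitSum₃, splitSum, LinearMap.add_apply, LinearMap.sum_apply, LinearMap.comp_apply,
      map_add, map_sum, LinearMap.zero_apply, map_zero, Submodule.mkQ_apply] at h ⊢
    exact h
  unit := by
    refine Submodule.linearMap_qext _ (LinearMap.ext fun m => ?_)
    change (G.G t).mkQ (N.μ.1 [A.e] m) = (G.G t).mkQ m
    rw [N.unit, LinearMap.id_apply]
  unit_vanish x z h := by
    refine Submodule.linearMap_qext _ (LinearMap.ext fun m => ?_)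
    change (G.G t).mkQ (N.μ.1 (x ++ A.e :: z) m) = 0
    rw [N.unit_vanish x z h, LinearMap.zero_apply, map_zero]

/-- The projection `π_t : N → N_t`; it is a strict morphism of `A_∞`-modules. -/
def proj (t : ℤ) : N.carrier →ₗ[K] (G.quotient t).carrier := (G.G t).mkQ

/-- The pushforward `(π_t)_* : Hom^k(M, N) → Hom^k(M, N_t)`, that is, composition with the strict
morphism `π_t : N → N_t`. -/
def push (M : AInfModule A) (t : ℤ) (k : Γ) : HomDeg M N k →ₗ[K] HomDeg M (G.quotient t) k where
  toFun φ := ⟨⟨fun w => G.proj t ∘ₗ φ.1.1 w, fun x z => isLinearMap_comp_right (φ.1.2 x z) _⟩,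
    fun w d hw j m hm => Submodule.mem_map_of_mem (φ.2.1 w d hw j m hm),
    fun x z => by
      change G.proj t ∘ₗ φ.1.1 _ = 0
      rw [φ.2.2, LinearMap.comp_zero]⟩
  map_add' φ ψ := Subtype.ext <| Words.ext fun w => LinearMap.comp_add _ _ _
  map_smul' c φ := Subtype.ext <| Words.ext fun w => LinearMap.comp_smul _ _ _

end Filtration

end AInf

/-! The projection factors as `N → N_n → N_{n+s} → ⋯ → N_{n+sp}`, a chain of `p + 1` strict
morphisms. Each of them vanishes in cohomology, and pushing forward along such a morphism gains one
step of the length filtration, up to homotopy.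

Gaining a step (`StrictHom.liftsBy_one`): over a field, a strict `f` that is zero in cohomology has
a contraction `h` of degree `-1` with `f = d h + h d`, where `d` is the part of the structure map
without inputs from `A`. Let `H` be composition with `h`, up to sign. Then `γ = f_* + dH + Hd` is a
cochain map homotopic to `f_*`. In `γ` the terms where `φ` is precomposed with the bar differential
cancel, and so do the terms with `μ⁰`. What survives involves `μⁿ` with `n ≥ 1`, which uses up at
least one further input from `A`. Hence `γ` sends `F^q` to `F^{q+1}`, and such lifts compose
(`LiftsBy.comp`). That `γ` commutes with the differential needs `d² = 0` on `Hom`, which is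
`preD_preD`; the convolution calculus serves this.

Vanishing in cohomology: `N → N_n` kills cohomology because every class of `H(N)` has a
representative in `G n`. For `N_t → N_{t+s}` with `t ≥ n`, a cocycle of `N_t` is the class of some
`x` with `d x ∈ G t`. Degeneration at the page `s + 1` gives `y ∈ G (t + s)` with `d y = d x`
(`DegeneratesAt.exists_d_eq`). Then `x - y` is a cocycle, so it is cohomologous to an element of `G
n ≤ G (t + s)`, and `x` becomes a coboundary in `N_{t+s}`. -/

namespace AInf

/-! ### Sums over factorisations of words -/

section SplitSum

variable {V B : Type*} [AddCommGroup B]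

/-- Coassociativity of deconcatenation. -/
theorem splitSum_assoc (G : List V → List V → List V → B) (w : List V) :
    splitSum (fun l z => splitSum (fun x y => G x y z) l) w = splitSum₃ G w := by
  induction w generalizing G with
  | nil => simp [splitSum₃, splitSum_nil]
  | cons a w ih =>
    simp only [splitSum₃, splitSum_cons, splitSum_nil, splitSum_add] at ih ⊢
    rw [ih fun x y z => G (a :: x) y z, add_assoc]

theorem splitSum_map {W : Type*} (g : V → W) (G : List W → List W → B) (w : List V) :
    splitSum G (w.map g) = splitSum (fun x y => G (x.map g) (y.map g)) w := by
  simp [splitSum, List.map_take, List.map_drop]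

theorem splitSum_comm {W : Type*} (G : List V → List V → List W → List W → B) (v : List V)
    (w : List W) : splitSum (fun x y => splitSum (fun p q => G x y p q) w) v =
      splitSum (fun p q => splitSum (fun x y => G x y p q) v) w :=
  Finset.sum_comm

theorem splitSum_neg (G : List V → List V → B) (w : List V) :
    splitSum (fun x y => -G x y) w = -splitSum G w := by
  simp [splitSum]

/-- The marked letter `a` lies in the last, the middle or the first factor. With `a` a value of `μ`,
this is the case split behind `b_A² = 0`. -/
theorem splitSum₃_append_cons (G : List V → List V → List V → B) (x z : List V) (a : V) :
    splitSum₃ G (x ++ a :: z) =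
      splitSum₃ (fun p q r => G p q (r ++ a :: z)) x +
      splitSum (fun p q => splitSum (fun r s => G p (q ++ a :: r) s) z) x +
      splitSum₃ (fun p q r => G (x ++ a :: p) q r) z := by
  simp only [splitSum₃, splitSum_append_cons, splitSum_add]

theorem splitSum_eq_nil {G : List V → List V → B} (w : List V)
    (h : ∀ x y, x ++ y = w → x ≠ [] → G x y = 0) : splitSum G w = G [] w := by
  cases w with
  | nil => exact splitSum_nil G
  | cons a z =>
    rw [splitSum_cons, splitSum_eq_zero fun p q hpq => h _ _ (by rw [List.cons_append, hpq])
      (List.cons_ne_nil _ _), add_zero]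

end SplitSum

/-! ### Signs as scalars. -/

section Sign

variable {Γ : Type*} (K : Type*) [Field K] [CommRing Γ] [Module Γ (Additive ℤˣ)]

/-- The sign `(-1) ^ k` as a scalar. -/
def sgn (k : Γ) : K := ((((-1 : ℤˣ) ^ k : ℤˣ) : ℤ) : K)

variable {K}

theorem sgn_add (k l : Γ) : sgn K (k + l) = sgn K k * sgn K l := by
  simp [sgn, uzpow_add]

theorem sgn_zero : sgn K (0 : Γ) = 1 := by simp [sgn]

theorem sgn_one : sgn K (1 : Γ) = -1 := by simp [sgn]

theorem sgn_mul_self (k : Γ) : sgn K k * sgn K k = 1 := by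
  rw [sgn, ← Int.cast_mul, ← Units.val_mul, Int.units_mul_self]
  simp

theorem sgn_add_one (k : Γ) : sgn K (k + 1) = -sgn K k := by
  rw [sgn_add, sgn_one, mul_neg, mul_one]

theorem sgn_sub_one (k : Γ) : sgn K (k - 1) = -sgn K k := by
  rw [← neg_eq_iff_eq_neg, ← sgn_add_one, sub_add_cancel]

end Sign

variable {K Γ : Type*} [Field K] [CommRing Γ] [DecidableEq Γ] [Module Γ (Additive ℤˣ)]
  {A : AInfAlgebra K Γ}

/-! ### Koszul signs on homogeneous words. -/

section Kos

variable {B : Type*} [AddCommGroup B] [Module K B]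

/-- Multilinear families are determined by their values at homogeneous words. -/
theorem Words.ext_of_isHomWord {f g : Words K A.carrier B}
    (h : ∀ w d, IsHomWord A.sgr w d → f.1 w = g.1 w) : f = g := by
  -- Letters are moved one at a time from the arbitrary suffix `z` to the homogeneous prefix `x`,
  -- after being split into homogeneous components.
  have key : ∀ (z x : List A.carrier) (d : Γ), IsHomWord A.sgr x d →
      f.1 (x ++ z) = g.1 (x ++ z) := by
    intro z
    induction z with
    | nil => intro x d hx; simpa using h x d hx
    | cons a z ih =>
      intro x d hx
      induction a using DirectSum.Decomposition.inductionOn A.gr with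
      | zero => rw [Words.map_zero, Words.map_zero]
      | homogeneous m =>
        rename_i i
        have hm : m.1 ∈ A.sgr (i - 1) := by
          rw [AInfAlgebra.sgr, sub_add_cancel]
          exact m.2
        simpa using ih (x ++ [m.1]) _ (hx.append (.cons hm .nil))
      | add a b ha hb => rw [(f.2 x z).map_add, (g.2 x z).map_add, ha, hb]
  exact Words.ext fun w => key w [] 0 .nil

theorem AInfAlgebra.kos_of_mem (k : Γ) {i : Γ} {a : A.carrier} (ha : a ∈ A.sgr i) :
    A.kos k a = sgn K (k * i) • a := by
  rw [AInfAlgebra.kos, signMap_of_mem A.gr _ ha, add_sub_cancel_right]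
  rfl

theorem Words.apply_map_kos (f : Words K A.carrier B) (k : Γ) {w : List A.carrier} {d : Γ}
    (hw : IsHomWord A.sgr w d) (x : List A.carrier) :
    f.1 (x ++ w.map (A.kos k)) = sgn K (k * d) • f.1 (x ++ w) := by
  induction hw generalizing x with
  | nil => simp [sgn_zero]
  | @cons a i l d ha _ ih =>
    rw [List.map_cons, AInfAlgebra.kos_of_mem k ha, (f.2 _ _).map_smul, mul_add, sgn_add,
      mul_smul]
    have := ih (x ++ [a])
    simp only [List.append_assoc, List.cons_append, List.nil_append] at this
    rw [this]

/-- The structure map of `A` has degree one. -/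
theorem AInfAlgebra.kos_μ (k : Γ) (w : List A.carrier) :
    A.kos k (A.μ.1 w) = sgn K k • A.μ.1 (w.map (A.kos k)) := by
  have h : (⟨fun w => A.kos k (A.μ.1 w), fun x z => (A.kos k ∘ₗ (A.μ.2 x z).mk' _).isLinear⟩ :
      Words K A.carrier A.carrier) =
      sgn K k • ⟨fun w => A.μ.1 (w.map (A.kos k)), Words.isLinearMap_map A.μ (A.kos k)⟩ := by
    refine Words.ext_of_isHomWord fun w d hw => ?_
    have h₁ := A.kos_of_mem k (i := d + 1) (A.μ_degree w d hw)
    have h₂ := Words.apply_map_kos A.μ k hw []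
    rw [List.nil_append, List.nil_append] at h₂
    change A.kos k (A.μ.1 w) = sgn K k • A.μ.1 (w.map (A.kos k))
    rw [h₁, h₂, smul_smul, mul_add, mul_one, sgn_add, mul_comm]
  exact congrFun (congrArg Subtype.val h) w

theorem AInfAlgebra.kos_kos (k l : Γ) (a : A.carrier) : A.kos k (A.kos l a) = A.kos (k + l) a := by
  induction a using DirectSum.Decomposition.inductionOn A.gr with
  | zero => simp only [map_zero]
  | homogeneous m =>
    rename_i i
    have hm : m.1 ∈ A.sgr (i - 1) := by
      rw [AInfAlgebra.sgr, sub_add_cancel]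
      exact m.2
    rw [A.kos_of_mem _ hm, A.kos_of_mem _ hm, map_smul, A.kos_of_mem _ hm, smul_smul, add_mul,
      sgn_add, mul_comm]
  | add a b ha hb => simp only [map_add, ha, hb]

theorem AInfAlgebra.relation' (w : List A.carrier) :
    splitSum₃ (fun x y z => A.μ.1 (x.map (A.kos 1) ++ A.μ.1 y :: z)) w = 0 := by
  simpa only [AInfAlgebra.kos, one_mul] using A.relation w

theorem AInfAlgebra.kos_one_kos_one (a : A.carrier) : A.kos 1 (A.kos 1 a) = a := by
  induction a using DirectSum.Decomposition.inductionOn A.gr with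
  | zero => simp only [map_zero]
  | homogeneous m =>
    rename_i i
    have hm : m.1 ∈ A.sgr (i - 1) := by
      rw [AInfAlgebra.sgr, sub_add_cancel]
      exact m.2
    rw [A.kos_of_mem _ hm, map_smul, A.kos_of_mem _ hm, smul_smul, sgn_mul_self, one_smul]
  | add a b ha hb => simp only [map_add, ha, hb]

end Kos

/-! ### Convolution of families of maps on words -/

section Convolution

variable {X Y Z W : Type*} [AddCommGroup X] [Module K X] [AddCommGroup Y] [Module K Y]
  [AddCommGroup Z] [Module K Z] [AddCommGroup W] [Module K W]

/-- The convolution product `f ∘ (1 ⊗ g) ∘ Δ`. -/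
def conv (f : List A.carrier → (Y →ₗ[K] Z)) (g : List A.carrier → (X →ₗ[K] Y)) :
    List A.carrier → (X →ₗ[K] Z) :=
  splitSum fun x y => f x ∘ₗ g y

/-- Application of the Koszul sign of a map of degree `k` to all letters. -/
def twist {B : Type*} (k : Γ) (f : List A.carrier → B) : List A.carrier → B := fun w => f (w.map (A.kos k))

/-- Composition with the bar differential `b_A`. -/
def barD {B : Type*} [AddCommGroup B] (f : List A.carrier → B) : List A.carrier → B :=
  splitSum₃ fun x y z => f (x.map (A.kos 1) ++ A.μ.1 y :: z)

theorem comp_splitSum (f : Y →ₗ[K] Z) (G : List A.carrier → List A.carrier → (X →ₗ[K] Y))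
    (w : List A.carrier) : f ∘ₗ splitSum G w = splitSum (fun x y => f ∘ₗ G x y) w :=
  map_splitSum (LinearMap.llcomp K X Y Z f) G w

theorem splitSum_comp (f : X →ₗ[K] Y) (G : List A.carrier → List A.carrier → (Y →ₗ[K] Z))
    (w : List A.carrier) : splitSum G w ∘ₗ f = splitSum (fun x y => G x y ∘ₗ f) w :=
  map_splitSum (LinearMap.lcomp K Z f) G w

theorem conv_assoc (f : List A.carrier → (Z →ₗ[K] W)) (g : List A.carrier → (Y →ₗ[K] Z))
    (h : List A.carrier → (X →ₗ[K] Y)) : conv (conv f g) h = conv f (conv g h) := by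
  funext w
  simp only [conv, splitSum_comp, comp_splitSum]
  rw [splitSum_assoc (fun x y z => (f x ∘ₗ g y) ∘ₗ h z)]
  rfl

theorem twist_conv (k : Γ) (f : List A.carrier → (Y →ₗ[K] Z)) (g : List A.carrier → (X →ₗ[K] Y)) :
    twist k (conv f g) = conv (twist k f) (twist k g) :=
  funext fun w => splitSum_map (A.kos k) (fun x y => f x ∘ₗ g y) w

theorem twist_twist {B : Type*} (k l : Γ) (f : List A.carrier → B) : twist k (twist l f) = twist (k + l) f := by
  funext w
  simp only [twist, List.map_map]
  congr 2
  funext a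
  rw [Function.comp_apply, AInfAlgebra.kos_kos, add_comm]

theorem twist_one_twist_one {B : Type*} (f : List A.carrier → B) : twist 1 (twist 1 f) = f := by
  funext w
  simp only [twist, List.map_map]
  congr 1
  exact (List.map_congr_left fun a _ => A.kos_one_kos_one a).trans (List.map_id' w)

/-- The bar differential is a coderivation. -/
theorem barD_conv (f : List A.carrier → (Y →ₗ[K] Z)) (g : List A.carrier → (X →ₗ[K] Y)) :
    barD (conv f g) = conv (barD f) g + conv (twist 1 f) (barD g) := by
  funext w
  have e₁ : conv (barD f) g w = splitSum (fun x r => splitSum (fun y r => splitSum (fun z u =>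
      f (x.map (A.kos 1) ++ A.μ.1 y :: z) ∘ₗ g u) r) r) w := by
    simp only [conv, barD, splitSum₃, splitSum_comp]
    rw [splitSum_assoc (fun x r u => splitSum (fun y z =>
      f (x.map (A.kos 1) ++ A.μ.1 y :: z) ∘ₗ g u) r), splitSum₃]
    congr 1
    funext x r
    exact splitSum_assoc (fun y z u => f (x.map (A.kos 1) ++ A.μ.1 y :: z) ∘ₗ g u) r
  -- The letters before the inserted `μ` that go to `f` still carry the Koszul sign of `b_A`; hence
  -- the twist of `f`.
  have e₂ : conv (twist 1 f) (barD g) w = splitSum (fun x r => splitSum (fun y r => splitSum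
      (fun z u => f (x.map (A.kos 1)) ∘ₗ g (y.map (A.kos 1) ++ A.μ.1 z :: u)) r) r) w := by
    simp only [conv, twist, barD, splitSum₃, comp_splitSum]
  have e₃ : splitSum (fun x r => splitSum (fun z u => splitSum (fun p q =>
      f (p.map (A.kos 1)) ∘ₗ g (q.map (A.kos 1) ++ A.μ.1 z :: u)) x) r) w =
      conv (twist 1 f) (barD g) w := by
    rw [e₂]
    refine Eq.trans ?_ (splitSum_assoc (fun p q r => splitSum (fun z u =>
      f (p.map (A.kos 1)) ∘ₗ g (q.map (A.kos 1) ++ A.μ.1 z :: u)) r) w)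
    congr 1
    funext x r
    exact splitSum_comm (fun z u p q =>
      f (p.map (A.kos 1)) ∘ₗ g (q.map (A.kos 1) ++ A.μ.1 z :: u)) r x
  rw [Pi.add_apply, ← e₃, e₁]
  -- The cut of `x ++ μ y :: z` falls before or after the inserted letter, which gives the two
  -- terms.
  simp only [conv, barD, splitSum₃, splitSum_append_cons, splitSum_add, splitSum_map]
  exact add_comm _ _

theorem map_kos_one_map_kos_one (w : List A.carrier) : (w.map (A.kos 1)).map (A.kos 1) = w := by
  rw [List.map_map]
  exact (List.map_congr_left fun a _ => A.kos_one_kos_one a).trans (List.map_id' w)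

theorem twist_barD (k : Γ) (f : Words K A.carrier (X →ₗ[K] Y)) :
    barD (twist k f.1) = sgn K k • twist k (barD f.1) := by
  funext w
  rw [Pi.smul_apply, twist, barD, barD, splitSum₃, splitSum₃, splitSum_map, ← splitSum_smul]
  congr 1
  funext x r
  rw [splitSum_map, ← splitSum_smul]
  congr 1
  funext y z
  rw [twist, List.map_append, List.map_cons, A.kos_μ, (f.2 _ _).map_smul, List.map_map,
    List.map_map]
  have h : A.kos k ∘ A.kos 1 = A.kos 1 ∘ A.kos k := funext fun a => by
    rw [Function.comp_apply, Function.comp_apply, A.kos_kos, A.kos_kos, add_comm]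
  rw [h]

/-- The bar differential squares to zero. -/
theorem barD_barD (f : Words K A.carrier (X →ₗ[K] Y)) : barD (barD f.1) = 0 := by
  funext w
  -- Two disjoint insertions, the second to the left of the first, reindexed by the five pieces of
  -- `w` read from left to right.
  have t₁ : splitSum (fun x u => splitSum (fun y z => splitSum₃ (fun p q r =>
      f.1 (p ++ A.μ.1 (q.map (A.kos 1)) :: (r.map (A.kos 1) ++ A.μ.1 y :: z))) x) u) w =
      splitSum (fun p t => splitSum (fun q t => splitSum (fun r t => splitSum (fun y z =>
        f.1 (p ++ A.μ.1 (q.map (A.kos 1)) :: (r.map (A.kos 1) ++ A.μ.1 y :: z))) t) t) t) w := by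
    trans splitSum (fun x u => splitSum (fun p v => splitSum (fun y z => splitSum (fun q r =>
      f.1 (p ++ A.μ.1 (q.map (A.kos 1)) :: (r.map (A.kos 1) ++ A.μ.1 y :: z))) v) u) x) w
    · congr 1
      funext x u
      exact splitSum_comm (fun y z p v => splitSum (fun q r =>
        f.1 (p ++ A.μ.1 (q.map (A.kos 1)) :: (r.map (A.kos 1) ++ A.μ.1 y :: z))) v) u x
    rw [splitSum_assoc (fun p v u => splitSum (fun y z => splitSum (fun q r =>
      f.1 (p ++ A.μ.1 (q.map (A.kos 1)) :: (r.map (A.kos 1) ++ A.μ.1 y :: z))) v) u), splitSum₃]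
    congr 1
    funext p t
    refine Eq.trans ?_ (splitSum_assoc (fun q r u => splitSum (fun y z =>
      f.1 (p ++ A.μ.1 (q.map (A.kos 1)) :: (r.map (A.kos 1) ++ A.μ.1 y :: z))) u) t)
    congr 1
    funext v u
    exact splitSum_comm (fun y z q r =>
      f.1 (p ++ A.μ.1 (q.map (A.kos 1)) :: (r.map (A.kos 1) ++ A.μ.1 y :: z))) u v
  -- Nested insertions: for fixed outer pieces, the inner sum is the `A_∞`-relation of `A`.
  have t₂ : splitSum (fun x u => splitSum (fun y z => splitSum (fun p q => splitSum (fun r s =>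
      f.1 (p ++ A.μ.1 (q.map (A.kos 1) ++ A.μ.1 y :: r) :: s)) z) x) u) w = 0 := by
    trans splitSum (fun x u => splitSum (fun p q => splitSum (fun y z => splitSum (fun r s =>
      f.1 (p ++ A.μ.1 (q.map (A.kos 1) ++ A.μ.1 y :: r) :: s)) z) u) x) w
    · congr 1
      funext x u
      exact splitSum_comm (fun y z p q => splitSum (fun r s =>
        f.1 (p ++ A.μ.1 (q.map (A.kos 1) ++ A.μ.1 y :: r) :: s)) z) u x
    rw [splitSum_assoc (fun p q u => splitSum (fun y z => splitSum (fun r s =>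
      f.1 (p ++ A.μ.1 (q.map (A.kos 1) ++ A.μ.1 y :: r) :: s)) z) u), splitSum₃]
    refine splitSum_eq_zero fun p t _ => ?_
    have h : ∀ m s, splitSum₃ (fun q y r =>
        f.1 (p ++ A.μ.1 (q.map (A.kos 1) ++ A.μ.1 y :: r) :: s)) m = 0 := by
      intro m s
      have := congrArg ((f.2 p s).mk' _) (A.relation' m)
      rw [map_zero, splitSum₃, map_splitSum] at this
      simp only [map_splitSum] at this
      exact this
    trans splitSum (fun m s => splitSum₃ (fun q y r =>
        f.1 (p ++ A.μ.1 (q.map (A.kos 1) ++ A.μ.1 y :: r) :: s)) m) t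
    · simp only [splitSum₃]
      rw [splitSum_assoc (fun q k s => splitSum (fun y r =>
        f.1 (p ++ A.μ.1 (q.map (A.kos 1) ++ A.μ.1 y :: r) :: s)) k), splitSum₃]
      congr 1
      funext q u
      exact (splitSum_assoc (fun y r s =>
        f.1 (p ++ A.μ.1 (q.map (A.kos 1) ++ A.μ.1 y :: r) :: s)) u).symm
    · simp only [h, splitSum_zero]
  have e : barD (barD f.1) w =
      splitSum (fun x u => splitSum (fun y z => splitSum₃ (fun p q r =>
        f.1 (p ++ A.μ.1 (q.map (A.kos 1)) :: (r.map (A.kos 1) ++ A.μ.1 y :: z))) x) u) w +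
      splitSum (fun x u => splitSum (fun y z => splitSum (fun p q => splitSum (fun r s =>
        f.1 (p ++ A.μ.1 (q.map (A.kos 1) ++ A.μ.1 y :: r) :: s)) z) x) u) w +
      splitSum (fun x u => splitSum (fun y z => splitSum₃ (fun p q r =>
        f.1 (x ++ A.kos 1 (A.μ.1 y) :: (p.map (A.kos 1) ++ A.μ.1 q :: r))) z) u) w := by
    simp only [barD, splitSum₃_append_cons]
    simp only [splitSum₃, splitSum_add, splitSum_map, List.map_append, List.map_cons,
      map_kos_one_map_kos_one, List.append_assoc, List.cons_append]
  rw [e, t₂, t₁, add_zero]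
  -- The other order of disjoint insertions moves a map of degree one past `μ y`. The resulting sign
  -- makes it cancel against `t₁`.
  simp only [splitSum₃, A.kos_μ, sgn_one, neg_smul, one_smul]
  have hn : ∀ (p z : List A.carrier) (a : A.carrier), f.1 (p ++ (-a) :: z) = -f.1 (p ++ a :: z) :=
    fun p z => (f.2 p z).map_neg
  simp only [hn, splitSum_neg]
  exact add_neg_cancel _

theorem add_conv (f f' : List A.carrier → (Y →ₗ[K] Z)) (g : List A.carrier → (X →ₗ[K] Y)) :
    conv (f + f') g = conv f g + conv f' g := by
  funext w
  simp only [conv, Pi.add_apply, LinearMap.add_comp, splitSum_add]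

theorem conv_add (f : List A.carrier → (Y →ₗ[K] Z)) (g g' : List A.carrier → (X →ₗ[K] Y)) :
    conv f (g + g') = conv f g + conv f g' := by
  funext w
  simp only [conv, Pi.add_apply, LinearMap.comp_add, splitSum_add]

theorem smul_conv (c : K) (f : List A.carrier → (Y →ₗ[K] Z)) (g : List A.carrier → (X →ₗ[K] Y)) :
    conv (c • f) g = c • conv f g := by
  funext w
  simp only [conv, Pi.smul_apply, LinearMap.smul_comp, splitSum_smul]

theorem conv_smul (c : K) (f : List A.carrier → (Y →ₗ[K] Z)) (g : List A.carrier → (X →ₗ[K] Y)) :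
    conv f (c • g) = c • conv f g := by
  funext w
  simp only [conv, Pi.smul_apply, LinearMap.comp_smul, splitSum_smul]

theorem barD_add (f g : List A.carrier → (X →ₗ[K] Y)) : barD (f + g) = barD f + barD g := by
  funext w
  simp only [barD, splitSum₃, Pi.add_apply, splitSum_add]

theorem barD_smul (c : K) (f : List A.carrier → (X →ₗ[K] Y)) : barD (c • f) = c • barD f := by
  funext w
  simp only [barD, splitSum₃, Pi.smul_apply, splitSum_smul]

end Convolution

/-! ### The differential on morphisms squares to zero. -/

section Differential

variable (M N : AInfModule A)

/-- The module relation as a Maurer–Cartan equation, oriented to eliminate products of two structure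
maps. -/
theorem AInfModule.conv_μ : conv (twist 1 M.μ.1) M.μ.1 = (-1 : K) • barD M.μ.1 := by
  rw [neg_one_smul]
  exact funext fun w => eq_neg_of_add_eq_zero_left (M.relation w)

theorem preD_coe (k : Γ) (φ : Words K A.carrier (M.carrier →ₗ[K] N.carrier)) :
    (preD M N k φ).1 = conv (twist 1 φ.1) M.μ.1 + barD φ.1 +
      (-sgn K k) • conv (twist k N.μ.1) φ.1 := by
  rw [neg_smul, ← sub_eq_add_neg]
  rfl

/-- `b_A² = 0` kills the pure bar term. By the coderivation rule and the module relations, the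
products of two `μ_M` or two `μ_N` cancel against bar differentials of one; the mixed terms cancel
by their Koszul signs. -/
theorem preD_preD (k : Γ) (φ : Words K A.carrier (M.carrier →ₗ[K] N.carrier)) :
    preD M N (k + 1) (preD M N k φ) = 0 := by
  refine Subtype.ext ?_
  have tw : ∀ f g : List A.carrier → (M.carrier →ₗ[K] N.carrier),
    twist 1 (f + g) = twist 1 f + twist 1 g := fun _ _ => rfl
  have tws : ∀ (c : K) (f : List A.carrier → (M.carrier →ₗ[K] N.carrier)),
    twist 1 (c • f) = c • twist 1 f := fun _ _ => rfl
  have htt : twist 1 (twist k N.μ.1) = twist (k + 1) N.μ.1 := by rw [twist_twist, add_comm]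
  have hN : conv (twist (k + 1) N.μ.1) (conv (twist k N.μ.1) φ.1) =
      (-1 : K) • conv (twist k (barD N.μ.1)) φ.1 := by
    have := congrArg (twist k) (N.conv_μ)
    rw [twist_conv, twist_twist] at this
    rw [← conv_assoc, this, ← smul_conv]
    rfl
  simp only [preD_coe, tw, tws, add_conv, conv_add, smul_conv, conv_smul, barD_add, barD_smul,
    barD_conv, twist_conv, barD_barD, twist_barD, twist_one_twist_one, conv_assoc,
    AInfModule.conv_μ, sgn_add_one, sgn_one, htt, hN, smul_add, neg_neg, smul_smul]
  have hs : (-sgn K k * sgn K k) = -1 := by rw [neg_mul, sgn_mul_self]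
  have hs' : (sgn K k * (-sgn K k * -1)) = 1 := by
    rw [mul_neg_one, neg_neg, sgn_mul_self]
  rw [hs, hs']
  change _ = (0 : List A.carrier → (M.carrier →ₗ[K] N.carrier))
  module

end Differential


/-! ### Null homotopies over a field -/

section LinearAlgebra

variable {V W : Type*} [AddCommGroup V] [Module K V] [AddCommGroup W] [Module K W]

/-- Every linear map over a field has a generalized inverse. -/
theorem exists_generalizedInverse (d : V →ₗ[K] W) :
    ∃ τ : W →ₗ[K] V, ∀ x, d (τ (d x)) = d x := by
  obtain ⟨g, hg⟩ := d.rangeRestrict.exists_rightInverse_of_surjective d.range_rangeRestrict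
  obtain ⟨τ, hτ⟩ := g.exists_extend
  refine ⟨τ, fun x => ?_⟩
  have h₁ : τ (d x) = g (d.rangeRestrict x) := LinearMap.congr_fun hτ (d.rangeRestrict x)
  rw [h₁]
  exact congrArg Subtype.val (LinearMap.congr_fun hg (d.rangeRestrict x))

/-- A map of complexes over a field that vanishes in cohomology is null homotopic. -/
theorem exists_nullHomotopy {d : V →ₗ[K] V} (hd : ∀ x, d (d x) = 0) {d' : W →ₗ[K] W}
    {f : V →ₗ[K] W} (hf : ∀ x, f (d x) = d' (f x)) (h₀ : ∀ x, d x = 0 → ∃ y, d' y = f x) :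
    ∃ h : V →ₗ[K] W, ∀ x, d' (h x) + h (d x) = f x := by
  obtain ⟨τ, hτ⟩ := exists_generalizedInverse d
  obtain ⟨δ, hδ⟩ := exists_generalizedInverse d'
  have hδ' : ∀ x, d x = 0 → d' (δ (f x)) = f x := fun x hx => by
    obtain ⟨y, hy⟩ := h₀ x hx
    rw [← hy, hδ]
  -- `1 - τ d` projects onto the cocycles and `d τ` onto the coboundaries. So `h` is zero on the
  -- image of `τ d`, is `f τ` on coboundaries, and is `δ f` on a complement of these in the
  -- cocycles, where `f` takes values in coboundaries.
  refine ⟨(δ ∘ₗ f ∘ₗ (LinearMap.id - d ∘ₗ τ) + f ∘ₗ τ ∘ₗ d ∘ₗ τ) ∘ₗ (LinearMap.id - τ ∘ₗ d),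
    fun x => ?_⟩
  simp only [LinearMap.comp_apply, LinearMap.add_apply, LinearMap.sub_apply, LinearMap.id_apply,
    hd, map_zero, sub_zero, hτ, sub_self, zero_add, map_add]
  have hy : d (x - τ (d x)) = 0 := by rw [map_sub, hτ, sub_self]
  obtain ⟨y, hx⟩ : ∃ y, y = x - τ (d x) := ⟨_, rfl⟩
  rw [← hx] at hy ⊢
  rw [hδ' _ (by rw [map_sub, hd, hy, sub_zero]), ← hf, hτ, map_sub, sub_add_cancel, hx, map_sub,
    sub_add_cancel]

end LinearAlgebra

/-- Strict morphisms of `A_∞`-modules. -/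
structure StrictHom (N P : AInfModule A) where
  toLin : N.carrier →ₗ[K] P.carrier
  map_mem : ∀ j, ∀ x ∈ N.gr j, toLin x ∈ P.gr j
  map_μ : ∀ w x, toLin (N.μ.1 w x) = P.μ.1 w (toLin x)

theorem AInfModule.d_mem (N : AInfModule A) {j : Γ} {x : N.carrier} (hx : x ∈ N.gr j) :
    N.d x ∈ N.gr (j + 1) := by
  have := N.μ_degree [] 0 .nil j x hx
  rwa [zero_add] at this

theorem AInfModule.decompose_d (N : AInfModule A) (x : N.carrier) (j : Γ) :
    (DirectSum.decompose N.gr (N.d x) j : N.carrier) =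
      N.d (DirectSum.decompose N.gr x (j - 1)) := by
  induction x using DirectSum.Decomposition.inductionOn N.gr with
  | zero => simp
  | homogeneous m =>
    rename_i i
    have hm := N.d_mem m.2
    by_cases h : i + 1 = j
    · subst h
      rw [DirectSum.decompose_of_mem_same _ hm, DirectSum.decompose_of_mem_same]
      rw [add_sub_cancel_right]
      exact m.2
    · rw [DirectSum.decompose_of_mem_ne _ hm h, DirectSum.decompose_of_mem_ne _ m.2, map_zero]
      rintro rfl
      exact h (sub_add_cancel _ _)
  | add a b ha hb => simp [ha, hb]

/-- The part of degree `-1` of a linear map between graded vector spaces. -/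
def degreeNegOnePart (N P : AInfModule A) (h : N.carrier →ₗ[K] P.carrier) :
    N.carrier →ₗ[K] P.carrier :=
  DirectSum.toModule K Γ _ (fun j => (P.gr (j - 1)).subtype ∘ₗ
      DirectSum.component K Γ (fun i => P.gr i) (j - 1) ∘ₗ
        (DirectSum.decomposeLinearEquiv P.gr).toLinearMap ∘ₗ h ∘ₗ (N.gr j).subtype) ∘ₗ
    (DirectSum.decomposeLinearEquiv N.gr).toLinearMap

theorem degreeNegOnePart_of_mem {N P : AInfModule A} (h : N.carrier →ₗ[K] P.carrier) {j : Γ}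
    {x : N.carrier} (hx : x ∈ N.gr j) :
    degreeNegOnePart N P h x = DirectSum.decompose P.gr (h x) (j - 1) := by
  rw [degreeNegOnePart, LinearMap.comp_apply, LinearEquiv.coe_coe,
    DirectSum.decomposeLinearEquiv_apply, DirectSum.decompose_of_mem N.gr hx,
    ← DirectSum.lof_eq_of K, DirectSum.toModule_lof]
  rfl

/-- A strict morphism that vanishes in cohomology is null homotopic as a map of graded
complexes. -/
theorem StrictHom.exists_nullHomotopy {N P : AInfModule A} (f : StrictHom N P)
    (h₀ : ∀ x, N.d x = 0 → ∃ y, P.d y = f.toLin x) :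
    ∃ h : N.carrier →ₗ[K] P.carrier, (∀ j, ∀ x ∈ N.gr j, h x ∈ P.gr (j - 1)) ∧
      ∀ x, P.d (h x) + h (N.d x) = f.toLin x := by
  obtain ⟨h, hh⟩ := AInf.exists_nullHomotopy N.d_d (d' := P.d) (f := f.toLin) (f.map_μ []) h₀
  -- Since `d` has degree one and `f` degree zero, only the part of degree `-1` of `h` contributes
  -- to `d h + h d = f` in the degree of `f`.
  refine ⟨degreeNegOnePart N P h, fun j x hx => ?_, fun x => ?_⟩
  · rw [degreeNegOnePart_of_mem h hx]
    exact SetLike.coe_mem _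
  · induction x using DirectSum.Decomposition.inductionOn N.gr with
    | zero => simp
    | homogeneous m =>
      rename_i j
      rw [degreeNegOnePart_of_mem h m.2, degreeNegOnePart_of_mem h (N.d_mem m.2),
        ← P.decompose_d, add_sub_cancel_right, ← Submodule.coe_add, ← DirectSum.add_apply,
        ← DirectSum.decompose_add, hh]
      exact DirectSum.decompose_of_mem_same _ (f.map_mem j _ m.2)
    | add a b ha hb => rw [map_add, map_add, map_add, map_add, map_add, ← ha, ← hb]; abel

/-! ### Pushforwards and the length filtration -/

section Push

variable (M : AInfModule A) {N P Q : AInfModule A}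

/-- Composition of a family of maps on words with a linear map. -/
def postcomp (f : N.carrier →ₗ[K] P.carrier) :
    Words K A.carrier (M.carrier →ₗ[K] N.carrier) →ₗ[K]
      Words K A.carrier (M.carrier →ₗ[K] P.carrier) where
  toFun φ := ⟨fun w => f ∘ₗ φ.1 w, fun x z => isLinearMap_comp_right (φ.2 x z) _⟩
  map_add' _ _ := Words.ext fun _ => LinearMap.comp_add _ _ _
  map_smul' _ _ := Words.ext fun _ => LinearMap.comp_smul _ _ _

theorem postcomp_mem (f : N.carrier →ₗ[K] P.carrier) {k l : Γ}
    (hf : ∀ j, ∀ x ∈ N.gr (j + k), f x ∈ P.gr (j + l))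
    {φ : Words K A.carrier (M.carrier →ₗ[K] N.carrier)} (hφ : φ ∈ HomDeg M N k) :
    postcomp M f φ ∈ HomDeg M P l :=
  ⟨fun w d hw j m hm => hf _ _ (hφ.1 w d hw j m hm), fun x z => by
    change f ∘ₗ φ.1 _ = 0
    rw [hφ.2, LinearMap.comp_zero]⟩

/-- The pushforward along a strict morphism. -/
def StrictHom.push (f : StrictHom N P) (k : Γ) : HomDeg M N k →ₗ[K] HomDeg M P k :=
  (postcomp M f.toLin).restrict fun _ => postcomp_mem M f.toLin fun _ => f.map_mem _

theorem preD_postcomp (f : StrictHom N P) (k : Γ)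
    (φ : Words K A.carrier (M.carrier →ₗ[K] N.carrier)) :
    preD M P k (postcomp M f.toLin φ) = postcomp M f.toLin (preD M N k φ) := by
  refine Words.ext fun w => ?_
  change preDFun M P k _ w = f.toLin ∘ₗ preDFun M N k φ w
  have hf : ∀ w, P.μ.1 w ∘ₗ f.toLin = f.toLin ∘ₗ N.μ.1 w := fun w =>
    LinearMap.ext fun x => (f.map_μ w x).symm
  have e : ∀ w, (postcomp M f.toLin φ).1 w = f.toLin ∘ₗ φ.1 w := fun _ => rfl
  simp only [preDFun, splitSum₃, LinearMap.comp_add, LinearMap.comp_sub, LinearMap.comp_smul,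
    comp_splitSum, e, ← LinearMap.comp_assoc, hf]

/-- The pushforwards `F` lift up to homotopy to a cochain map that raises the length filtration
by `a`. -/
def LiftsBy (F : ∀ k : Γ, HomDeg M N k →ₗ[K] HomDeg M P k) (a : ℕ) : Prop :=
  ∃ (γ : ∀ k : Γ, HomDeg M N k →ₗ[K] HomDeg M P k)
    (h : ∀ k : Γ, HomDeg M N (k + 1) →ₗ[K] HomDeg M P k),
    -- Asking for every `q`, not just `q = 0`, is what makes the gains add up under composition.
    (∀ q k, ∀ φ ∈ lengthFil M N q k, γ k φ ∈ lengthFil M P (q + a) k) ∧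
    (∀ k φ, homD M P k (γ k φ) = γ (k + 1) (homD M N k φ)) ∧
    -- Every degree has the form `k + 1`, so this form loses nothing and avoids transport along `k -
    -- 1 + 1 = k`.
    ∀ k φ, γ (k + 1) φ - F (k + 1) φ = homD M P k (h k φ) + h (k + 1) (homD M N (k + 1) φ)

variable {M}

theorem LiftsBy.comp {F : ∀ k : Γ, HomDeg M N k →ₗ[K] HomDeg M P k}
    {F' : ∀ k : Γ, HomDeg M P k →ₗ[K] HomDeg M Q k} {a b : ℕ} (hF : LiftsBy M F a)
    (hF' : LiftsBy M F' b)
    (hd : ∀ k φ, homD M Q k (F' k φ) = F' (k + 1) (homD M P k φ)) :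
    LiftsBy M (fun k => F' k ∘ₗ F k) (a + b) := by
  obtain ⟨γ, h, h₁, h₂, h₃⟩ := hF
  obtain ⟨γ', h', h₁', h₂', h₃'⟩ := hF'
  -- From `γ'γ - F'F = F'(γ - F) + (γ' - F')γ`.
  refine ⟨fun k => γ' k ∘ₗ γ k, fun k => F' k ∘ₗ h k + h' k ∘ₗ γ (k + 1), fun q k φ hφ => ?_,
    fun k φ => ?_, fun k φ => ?_⟩
  · rw [← add_assoc]
    exact h₁' _ _ _ (h₁ _ _ _ hφ)
  · simp only [LinearMap.comp_apply, h₂', h₂]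
  · have e := congrArg (F' (k + 1)) (sub_eq_iff_eq_add.1 (h₃ k φ))
    have e' := (sub_eq_iff_eq_add (G := HomDeg M Q (k + 1))).1 (h₃' k (γ (k + 1) φ))
    rw [map_add, map_add, ← hd] at e
    rw [e, h₂] at e'
    simp only [LinearMap.comp_apply, LinearMap.add_apply, map_add]
    rw [e']
    abel

variable (M)

/-- The pushforward along a strict morphism that vanishes in cohomology lifts up to homotopy to a
cochain map that raises the length filtration by one. -/
theorem StrictHom.liftsBy_one (f : StrictHom N P)
    (h₀ : ∀ x, N.d x = 0 → ∃ y, P.d y = f.toLin x) : LiftsBy M (f.push M) 1 := by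
  obtain ⟨h, hdeg, hh⟩ := f.exists_nullHomotopy h₀
  -- The sign `-(-1) ^ k` makes the `μ⁰` terms of `dH + Hd` equal to `-(d h + h d) φ = -f φ`. It
  -- alternates with `k`, so the terms of `φ` precomposed with the bar differential cancel.
  let H : Γ → Words K A.carrier (M.carrier →ₗ[K] N.carrier) →ₗ[K]
    Words K A.carrier (M.carrier →ₗ[K] P.carrier) := fun k => (-sgn K k) • postcomp M h
  have hH : ∀ k l, l + 1 = k → ∀ φ ∈ HomDeg M N k, H k φ ∈ HomDeg M P l := by
    rintro k l rfl φ hφ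
    refine Submodule.smul_mem _ _ (postcomp_mem M h (fun j x hx => ?_) hφ)
    have := hdeg _ x hx
    rwa [← add_assoc, add_sub_cancel_right] at this
  let γ : Γ → Words K A.carrier (M.carrier →ₗ[K] N.carrier) →ₗ[K]
    Words K A.carrier (M.carrier →ₗ[K] P.carrier) := fun k =>
      postcomp M f.toLin + preD M P (k - 1) ∘ₗ H k + H (k + 1) ∘ₗ preD M N k
  have hγ : ∀ k, ∀ φ ∈ HomDeg M N k, γ k φ ∈ HomDeg M P k := by
    intro k φ hφ
    refine add_mem (add_mem (f.push M k ⟨φ, hφ⟩).2 ?_) (hH _ _ rfl _ (preD_mem M N k φ hφ))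
    have := preD_mem M P (k - 1) _ (hH k (k - 1) (sub_add_cancel _ _) φ hφ)
    rwa [sub_add_cancel] at this
  refine ⟨fun k => (γ k).restrict (hγ k), fun k => (H (k + 1)).restrict (hH _ _ rfl), ?_, ?_, ?_⟩
  · intro q k φ hφ w hw
    -- As `w` has length at most `q`, a nonempty `x` leaves fewer than `q` letters for `φ`; only
    -- `μ⁰` then acts after `φ`.
    have hφ' : ∀ x y, x ++ y = w → x ≠ [] → φ.1.1 y = 0 := fun x y hxy hx => hφ y <| by
      have := congrArg List.length hxy
      have := List.length_pos_iff.2 hx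
      rw [List.length_append] at *
      omega
    have eN : splitSum (fun x y => N.μ.1 (x.map (A.kos k)) ∘ₗ φ.1.1 y) w = N.d ∘ₗ φ.1.1 w :=
      splitSum_eq_nil w fun x y hxy hx => by rw [hφ' x y hxy hx, LinearMap.comp_zero]
    have eP : splitSum (fun x y => P.μ.1 (x.map (A.kos (k - 1))) ∘ₗ h ∘ₗ φ.1.1 y) w =
        P.d ∘ₗ h ∘ₗ φ.1.1 w :=
      splitSum_eq_nil w fun x y hxy hx => by
        rw [hφ' x y hxy hx, LinearMap.comp_zero, LinearMap.comp_zero]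
    change f.toLin ∘ₗ φ.1.1 w + preDFun M P (k - 1) (H k φ.1) w +
      (-sgn K (k + 1)) • h ∘ₗ preDFun M N k φ.1 w = 0
    have e : ∀ w, (H k φ.1).1 w = (-sgn K k) • h ∘ₗ φ.1.1 w := fun _ => rfl
    have hf : f.toLin ∘ₗ φ.1.1 w = P.d ∘ₗ h ∘ₗ φ.1.1 w + h ∘ₗ N.d ∘ₗ φ.1.1 w :=
      LinearMap.ext fun m => (hh _).symm
    change _ + (_ + _ - sgn K (k - 1) • _) + _ • h ∘ₗ (_ + _ - sgn K k • _) = 0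
    simp only [e, LinearMap.smul_comp, LinearMap.comp_smul, splitSum_smul, splitSum₃, eN, eP, hf,
      LinearMap.comp_add, LinearMap.comp_sub, comp_splitSum, LinearMap.comp_assoc, sgn_add_one,
      sgn_sub_one]
    simp only [smul_smul, smul_sub, neg_mul_neg, neg_neg, sgn_mul_self, one_smul]
    module
  · intro k φ
    refine Subtype.ext ?_
    change preD M P k (γ k φ.1) = γ (k + 1) (preD M N k φ.1)
    have h₁ := preD_preD M P (k - 1) (H k φ.1)
    rw [sub_add_cancel] at h₁
    simp only [γ, LinearMap.add_apply, LinearMap.comp_apply, map_add, preD_postcomp, preD_preD,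
      map_zero, h₁, add_zero, add_sub_cancel_right]
  · intro k φ
    refine Subtype.ext ?_
    change γ (k + 1) φ.1 - postcomp M f.toLin φ.1 =
      preD M P k (H (k + 1) φ.1) + H (k + 1 + 1) (preD M N (k + 1) φ.1)
    simp only [γ, LinearMap.add_apply, LinearMap.comp_apply, add_sub_cancel_right]
    abel

end Push


/-! ### Consequences of finite length and of degeneration -/

namespace FilteredComplex

variable (C : FilteredComplex K)

theorem filH_mono : Monotone C.filH := fun _ _ h =>
  Submodule.map_mono (Submodule.comap_mono (C.mono h))

/-- `ℓ₊` is an infimum over integers: if `n` fails, then by monotonicity every admissible `k` is at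
least `n + 1`, so `ℓ₊ ≥ n + 1`. This includes the case of no admissible `k`, where `ℓ₊ = ∞`. -/
theorem filH_eq_top {n : ℕ} (h : C.length ≤ n) : C.filH n = ⊤ := by
  by_cases hC : Subsingleton C.H
  · exact Subsingleton.elim _ _
  rw [length, if_neg hC] at h
  have h₁ := (le_max_left _ _).trans h
  by_contra hn
  have h₂ : ((n + 1 : ℝ) : EReal) ≤ C.lengthPlus := by
    refine le_sInf ?_
    rintro _ ⟨k, rfl, hk⟩
    have hnk : (n : ℤ) < k := by
      by_contra hkn
      exact hn (top_le_iff.1 (hk ▸ C.filH_mono (not_lt.1 hkn)))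
    exact_mod_cast hnk
  have h₃ : C.lengthPlus ≤ (n : ℝ) := by
    generalize C.lengthPlus = x at h₁
    induction x with
    | bot => exact bot_le
    | top => exact absurd (h₁.trans_lt (ENNReal.natCast_lt_top n)) (lt_irrefl _)
    | coe x =>
      rw [EReal.abs_def, ENNReal.ofReal_le_natCast] at h₁
      exact EReal.coe_le_coe_iff.2 ((le_abs_self x).trans h₁)
  have h₄ := EReal.coe_le_coe_iff.1 (h₂.trans h₃)
  linarith

/-- If `H(C)_n = H(C)`, then every cocycle is cohomologous to one in `G n`. -/
theorem exists_sub_mem {n : ℤ} (h : C.filH n = ⊤) {x : C.V} (hx : C.d x = 0) :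
    ∃ w, x - C.d w ∈ C.G n := by
  have : (Submodule.mkQ _ ⟨x, hx⟩ : C.H) ∈ C.filH n := h ▸ Submodule.mem_top
  obtain ⟨⟨y, hy⟩, hyn, hyx⟩ := this
  obtain ⟨w, hw⟩ : y - x ∈ LinearMap.range C.d :=
    (Submodule.Quotient.eq ((LinearMap.range C.d).submoduleOf (LinearMap.ker C.d))).1 hyx
  refine ⟨-w, ?_⟩
  rw [map_neg, hw, neg_sub, sub_sub_cancel]
  exact hyn

variable {C}

/-- Since `d_r [x] = 0`, the element `d x` lies in `B^r_{k-r}`, so it is `d z` up to a term of `G (k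
- r - 1)`. -/
theorem DegeneratesAt.exists_add {r₀ : ℤ} (h : C.DegeneratesAt r₀) {r : ℤ} (hr : r₀ ≤ r) {k : ℤ}
    {x : C.V} (hx : x ∈ C.G k) (hdx : C.d x ∈ C.G (k - r)) :
    ∃ z ∈ C.G (k - 1), C.d x - C.d z ∈ C.G (k - r - 1) := by
  have h₁ : C.pageD r k (Submodule.mkQ _ ⟨x, hx, hdx⟩) = 0 := by rw [h r hr k]; rfl
  have h₂ : C.d x ∈ C.B r (k - r) :=
    (Submodule.Quotient.mk_eq_zero ((C.B r (k - r)).submoduleOf (C.Z r (k - r)))).1 h₁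
  obtain ⟨y, hy, _, ⟨z, hz, rfl⟩, hyz⟩ := Submodule.mem_sup.1 h₂
  refine ⟨z, ?_, ?_⟩
  · have := hz.1
    rwa [show k - r + r - 1 = k - 1 by ring] at this
  · rw [← hyz, add_sub_cancel_right]
    exact hy.1

/-- If the spectral sequence degenerates at the page `s + 1`, then coboundaries in `G t` are
coboundaries of elements of `G (t + s)`. -/
theorem DegeneratesAt.exists_d_eq {s : ℕ} (h : C.DegeneratesAt (s + 1)) (hbot : C.G (-1) = ⊥)
    (hexh : ∀ x, ∃ k, x ∈ C.G k) (t : ℕ) {x : C.V} (hx : C.d x ∈ C.G (t - 1)) :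
    ∃ y ∈ C.G (t - 1 + s), C.d y = C.d x := by
  -- The level is `t - 1`, so that the induction starts at `G (-1) = ⊥`.
  induction t generalizing x with
  | zero =>
    have : C.d x ∈ C.G (-1) := by simpa using hx
    rw [hbot, Submodule.mem_bot] at this
    exact ⟨0, zero_mem _, by rw [map_zero, this]⟩
  | succ t ih =>
    -- `m` is the excess of the level of `x` over the target. Vanishing of `d_{s+1+m}` gives `z` one
    -- level lower with `d (x - z)` in the previous level of the outer induction. That induction
    -- supplies `y`, and `y + z` replaces `x` with smaller excess.
    have key : ∀ (m : ℕ) (x : C.V), x ∈ C.G (((t + 1 : ℕ) : ℤ) - 1 + s + m) →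
        C.d x ∈ C.G ((t + 1 : ℕ) - 1) → ∃ y ∈ C.G ((t + 1 : ℕ) - 1 + s), C.d y = C.d x := by
      intro m
      induction m with
      | zero => exact fun x hx _ => ⟨x, by simpa using hx, rfl⟩
      | succ m ihm =>
        intro x hx hdx
        obtain ⟨z, hz, hzx⟩ := h.exists_add (r := s + 1 + m) (by omega) hx (by
          convert hdx using 2; push_cast; ring)
        rw [← map_sub] at hzx
        obtain ⟨y, hy, hyx⟩ := ih (x := x - z) (by convert hzx using 2; push_cast; ring)
        have e : C.d (y + z) = C.d x := by rw [map_add, hyx, map_sub, sub_add_cancel]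
        rw [← e]
        refine ihm _ (add_mem (C.mono ?_ hy) (C.mono ?_ hz)) (e ▸ hdx)
        · push_cast; omega
        · push_cast; omega
    obtain ⟨k, hk⟩ := hexh x
    refine key (k - t).toNat x (C.mono ?_ hk) hx
    push_cast
    have := Int.self_le_toNat (k - t)
    omega

end FilteredComplex

/-! ### Projections onto quotients -/

namespace Filtration

variable {N : AInfModule A} (G : Filtration N)

/-- The projection `N → N_t` as a strict morphism. -/
def projHom (t : ℤ) : StrictHom N (G.quotient t) where
  toLin := G.proj t
  map_mem _ _ hx := Submodule.mem_map_of_mem hx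
  map_μ _ _ := rfl

/-- The projection `N_t → N_u` for `t ≤ u` as a strict morphism. -/
def factorHom {t u : ℤ} (h : t ≤ u) : StrictHom (G.quotient t) (G.quotient u) where
  toLin := Submodule.factor (G.mono h)
  map_mem := by
    rintro j _ ⟨x, hx, rfl⟩
    exact ⟨x, hx, rfl⟩
  map_μ w x := by
    obtain ⟨x, rfl⟩ := Submodule.mkQ_surjective _ x
    rfl

variable {G} {n s : ℕ}

theorem projHom_vanishes (hn : G.complex.filH n = ⊤) (x : N.carrier) (hx : N.d x = 0) :
    ∃ y, (G.quotient n).d y = (G.projHom n).toLin x := by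
  obtain ⟨w, hw⟩ := G.complex.exists_sub_mem hn hx
  exact ⟨(G.G n).mkQ w, ((Submodule.Quotient.eq (G.G n)).2 hw).symm⟩

theorem factorHom_vanishes (hbot : G.G (-1) = ⊥) (hexh : ∀ x, ∃ k, x ∈ G.G k)
    (hn : G.complex.filH n = ⊤) (hdeg : G.complex.DegeneratesAt (s + 1)) {t : ℤ} (ht : n ≤ t)
    (x : (G.quotient t).carrier) (hx : (G.quotient t).d x = 0) :
    ∃ y, (G.quotient (t + s)).d y =
      (G.factorHom (le_add_of_nonneg_right (Int.natCast_nonneg s))).toLin x := by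
  obtain ⟨x, rfl⟩ := Submodule.mkQ_surjective _ x
  have hx' : N.d x ∈ G.G t := (Submodule.Quotient.mk_eq_zero (G.G t)).1 hx
  -- `exists_d_eq` takes a natural number and uses the level one below it; here `t ≥ n ≥ 0`.
  have et : ((t + 1).toNat : ℤ) - 1 = t := by omega
  obtain ⟨y, hy, hyx⟩ : ∃ y : N.carrier, y ∈ G.G (((t + 1).toNat : ℤ) - 1 + s) ∧
      N.d y = N.d x :=
    hdeg.exists_d_eq hbot hexh (t + 1).toNat (x := x) (by rw [et]; exact hx')
  rw [et] at hy
  obtain ⟨w, hw⟩ : ∃ w : N.carrier, x - y - N.d w ∈ G.G n :=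
    G.complex.exists_sub_mem hn (x := (x - y : N.carrier)) <| by
      change N.d (x - y) = 0
      rw [map_sub, hyx, sub_self]
  refine ⟨(G.G (t + s)).mkQ w, ((Submodule.Quotient.eq (G.G (t + s))).2 ?_).symm⟩
  have hw' : x - y - N.d w ∈ G.G (t + s) := G.mono (by omega) hw
  have := add_mem hw' hy
  rwa [sub_right_comm, sub_add_cancel] at this

theorem liftsBy_push (M : AInfModule A) (hbot : G.G (-1) = ⊥) (hexh : ∀ x, ∃ k, x ∈ G.G k)
    (hn : G.complex.filH n = ⊤) (hdeg : G.complex.DegeneratesAt (s + 1)) (p : ℕ) (t : ℤ)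
    (ht : t = n + s * p) : LiftsBy M (G.push M t) (p + 1) := by
  induction p generalizing t with
  | zero =>
    obtain rfl : t = n := by simpa using ht
    rw [zero_add]
    exact (G.projHom n).liftsBy_one M (projHom_vanishes hn)
  | succ p ih =>
    -- The quotient depends on its index, so the index stays a variable and `t` is replaced by `u +
    -- s`. The projection to `N_{u+s}` is then definitionally the composite through `N_u`.
    obtain ⟨u, hu⟩ : ∃ u : ℤ, u = n + s * p := ⟨_, rfl⟩
    obtain rfl : t = u + s := by rw [ht, hu]; push_cast; ring
    have hnu : (n : ℤ) ≤ u := by rw [hu]; exact le_add_of_nonneg_right (by positivity)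
    exact (ih u hu).comp ((G.factorHom _).liftsBy_one M
      (factorHom_vanishes hbot hexh hn hdeg hnu)) fun k φ =>
        Subtype.ext (preD_postcomp M (G.factorHom _) k φ.1)

end Filtration

end AInf

theorem mainTheorem9 {K Γ : Type*} [Field K] [CommRing Γ] [DecidableEq Γ]
    [Module Γ (Additive ℤˣ)] {A : AInf.AInfAlgebra K Γ} (M N : AInf.AInfModule A)
    (G : AInf.Filtration N) (hbot : G.G (-1) = ⊥) (hexh : ∀ x, ∃ k, x ∈ G.G k) (n s : ℕ)
    (hlen : G.complex.length ≤ n) (hdeg : G.complex.DegeneratesAt (s + 1)) (p : ℕ) :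
    ∃ (γ : ∀ k : Γ, AInf.HomDeg M N k →ₗ[K] AInf.HomDeg M (G.quotient (n + s * p)) k)
      (h : ∀ k : Γ, AInf.HomDeg M N (k + 1) →ₗ[K] AInf.HomDeg M (G.quotient (n + s * p)) k),
      (∀ k φ, γ k φ ∈ AInf.lengthFil M (G.quotient (n + s * p)) (p + 1) k) ∧
      (∀ k φ, AInf.homD M (G.quotient (n + s * p)) k (γ k φ) =
        γ (k + 1) (AInf.homD M N k φ)) ∧
      ∀ k φ, γ (k + 1) φ - G.push M (n + s * p) (k + 1) φ =
        AInf.homD M (G.quotient (n + s * p)) k (h k φ) +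
          h (k + 1) (AInf.homD M N (k + 1) φ) := by
  obtain ⟨γ, h, h₁, h₂, h₃⟩ := AInf.Filtration.liftsBy_push M hbot hexh
    (G.complex.filH_eq_top hlen) hdeg p _ rfl
  refine ⟨γ, h, fun k φ => ?_, h₂, h₃⟩
  -- Every morphism lies in `F^0`, so a gain of `p + 1` lands in `F^{p+1}`.
  rw [← zero_add (p + 1)]
  exact h₁ 0 k φ fun w hw => absurd hw (Nat.not_lt_zero _)
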